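/- **Model.** There are $J\ge 1$ customer (message) classes and at most $K\ge 1$ customers are served per time slot. A schedule is $s\in\mathbb Z_{\ge 0}^J$; let $\mathcal S_K=\{s:\sum_j s_j\le K\}$ and $\overline{\mathcal S}_K=\{s:\sum_j s_j=K\}$. A class-$j$ customer has service requirement $S_j>0$ and, if scheduled under $s$, is offered in that slot a service quantum $\phi_j(s)$, where $\phi_j(s)>0$ if $s_j>0$ and $\phi_j(s)=0$ if $s_j=0$ (arbitrary otherwise; for random coding with independent decoding over a multiaccess channel, $\phi_j(s)$ is the random-coding exponent $E^s_{o,j}(\rho,Q_j)>0$ of the effective channel seen by a class-$j$ message). A state $\alpha$ lists, for each class $j$, the residual service requirements $x_j(1),\dots,x_j(n_j(\alpha))>0$ of the class-$j$ customers present, each being $S_j$ minus a finite sum of quanta $\phi_j(s)$; $n(\alpha)=\sum_j n_j(\alpha)$. In each slot a schedule $s$ with $s_j\le n_j(\alpha)$ is drawn from a distribution depending only on $\alpha$; the first $s_j$ customers of queue $j$ each receive $\phi_j(s)$ and leave if this is at least their residual requirement; then $A_j$ new class-$j$ customers join the end of queue $j$, where the $A_j$ are independent over classes and slots, i.i.d.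 over slots, with $\mathbb E A_j^2<\infty$. The policy is *non-idling* ($\omega\in\Omega_K$): it uses schedules in $\mathcal S_K$, and schedules in $\overline{\mathcal S}_K$ whenever $n(\alpha)\ge K$. Put $\underline\phi_j=\min\{\phi_j(s):s\in\overline{\mathcal S}_K,\ s_j>0\}$ and $\overline\phi_j=\max_{s\in\mathcal S_K}\phi_j(s)$. The Markov chain is considered on a set $C$ of states that no transition leaves. For irreducible $C$, it is *stable* if it is positive recurrent and $n(\alpha)$ has finite stationary mean; and, for a function $c\ge 1$, it is *$c$-regular* if $C$ has a countable cover by sets $Y\subseteq C$ such that $\sup_{\alpha\in Y}\mathbb E_\alpha\big[\sum_{n=0}^{\tau_{Y'}-1}c(X_n)\big]<\infty$ for every nonempty $Y'\subseteq C$, where $\tau_{Y'}=\min\{n\ge1:X_n\in Y'\}$. For general $C$, the chain is *unstable* if it is transient, i.e. every state of $C$ has a positive probability of never being revisited. Condition (U): from every state of $C$, states of $C$ with arbitrarily many customers can be reached with positive probability (this holds, e.g., if $C$ is irreducible and $n$ is unbounded on $C$). **Theorem.** Let $K\ge1$, $J\ge1$ and $\omega\in\Omega_K$. 1. If $C$ is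 irreducible and $\sum_j\mathbb E A_j\lceil S_j/\underline\phi_j\rceil<K$, then the chain on $C$ is stable, and $c$-regular for $c(\alpha)=1+\sum_j\sum_{k\le n_j(\alpha)}\lceil x_j(k)/\underline\phi_j\rceil$. 2. If $C$ is irreducible and $\sum_j\mathbb E A_j(S_j+\overline\phi_j)<\min_{s\in\overline{\mathcal S}_K}\sum_j s_j\phi_j(s)$, then the chain on $C$ is stable, and $c$-regular for $c(\alpha)=1+\sum_j\sum_{k\le n_j(\alpha)}(x_j(k)+\overline\phi_j)$. 3. If (U) holds and, for some nonempty $B\subseteq\{1,\dots,J\}$, $\sum_{j\in B}S_j\mathbb E A_j>\max_{s\in\overline{\mathcal S}_K}\sum_{j\in B}s_j\phi_j(s)$, then the chain on $C$ is unstable. 4. (A) Let $K=1$ or $J=1$. The chain on $C$ is (i) stable if $C$ is irreducible and $\sum_j\mathbb E A_j\lceil S_j/\underline\phi_j\rceil<K$; (ii) unstable if $\sum_j\mathbb E A_j\lceil S_j/\underline\phi_j\rceil>K$ and, in the case $K\ge2$, (U) holds. 5. (B) Gaussian encoding: let $0<\rho\le1$, let $P_j>0$ be the received powers and $N_0W>0$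 the noise power, and for $s_j>0$ let $$\phi_j(s)=\rho\ln\Big(1+\frac{P_j}{(1+\rho)\big[\sum_k s_kP_k-P_j+N_0W\big]}\Big).$$ (i) If $\sum_j\mathbb E A_jS_j<\frac{\rho}{1+\rho}$, then for all sufficiently large $K$ and all $\omega\in\Omega_K$ the chain is stable on every irreducible $C$. (ii) If $\sum_j\mathbb E A_jS_j>\frac{\rho}{1+\rho}$, then for all sufficiently large $K$ and all $\omega\in\Omega_K$ the chain is unstable on every $C$ satisfying (U). The threshold $\rho/(1+\rho)$ does not depend on the received powers $P_j$. -/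

import Mathlib

open scoped ENNReal
open MeasureTheory

noncomputable section

/-! ### Markov chains given by a transition kernel `P : X → PMF X` -/

namespace MarkovChain

variable {X : Type*}

/-- `C` can serve as a state space of the chain: no transition leaves `C`. -/
def IsClosedSet (P : X → PMF X) (C : Set X) : Prop :=
  ∀ α ∈ C, ∀ β, P α β ≠ 0 → β ∈ C

/-- `β` is reached from `α` in finitely many (possibly zero) steps with positive probability. -/
def Accessible (P : X → PMF X) (α β : X) : Prop :=
  Relation.ReflTransGen (fun x y => P x y ≠ 0) α β

/-- The chain restricted to `C` is an irreducible Markov chain. -/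
structure IsIrreducibleOn (P : X → PMF X) (C : Set X) : Prop where
  nonempty : C.Nonempty
  closed : IsClosedSet P C
  communicate : ∀ α ∈ C, ∀ β ∈ C, Accessible P α β

open Classical in
/-- `avoid P Y c n α = 𝔼_α [c (X_n) ; τ_Y > n]`, where `τ_Y = min {n ≥ 1 : X_n ∈ Y}`. -/
def avoid (P : X → PMF X) (Y : Set X) (c : X → ℝ≥0∞) : ℕ → X → ℝ≥0∞
  | 0, α => c α
  | n + 1, α => ∑' β, P α β * (if β ∈ Y then 0 else avoid P Y c n β)

/-- `𝔼_α [∑_{n = 0}^{τ_Y - 1} c (X_n)]`. -/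
def expectedCost (P : X → PMF X) (Y : Set X) (c : X → ℝ≥0∞) (α : X) : ℝ≥0∞ :=
  ∑' n, avoid P Y c n α

/-- The mean return time to `α` is finite. -/
def IsPositiveRecurrentState (P : X → PMF X) (α : X) : Prop :=
  expectedCost P {α} (fun _ => 1) α < ⊤

/-- Starting from `α`, the chain never returns to `α` with positive probability
`ℙ_α (τ_α = ∞) = inf_n ℙ_α (τ_α > n)`. -/
def IsTransientState (P : X → PMF X) (α : X) : Prop :=
  0 < ⨅ n, avoid P {α} (fun _ => 1) n α

/-- `c`-regularity of the chain with state space `C`: there is a countable cover of `C` by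
`c`-regular sets. -/
def IsRegular (P : X → PMF X) (C : Set X) (c : X → ℝ≥0∞) : Prop :=
  ∃ U : ℕ → Set X, C ⊆ (⋃ i, U i) ∧ ∀ i, U i ⊆ C ∧
    ∀ Y ⊆ C, Y.Nonempty → (⨆ α ∈ U i, expectedCost P Y c α) < ⊤

/-- `π` is a stationary distribution of the chain with state space `C`. -/
def IsStationaryOn (P : X → PMF X) (C : Set X) (π : PMF X) : Prop :=
  π.support ⊆ C ∧ π.bind P = π

end MarkovChain

/-! ### The multiclass discrete-time processor-sharing queue -/

namespace Queue

open MarkovChain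

variable {J : ℕ}

/-- `s j` is the number of class-`j` customers served in a slot. -/
abbrev Schedule (J : ℕ) := Fin J → ℕ

/-- The `j`-th entry lists the residual service requirements in queue `j`, head of queue first. -/
abbrev State (J : ℕ) := Fin J → List ℝ

/-- The total number of customers `n(α)`. -/
def numCustomers (α : State J) : ℕ := ∑ j, (α j).length

/-- Schedules that serve at most `K` customers. -/
def schedulesLE (J K : ℕ) : Set (Schedule J) := {s | ∑ j, s j ≤ K}

/-- Schedules that serve exactly `K` customers. -/
def schedulesEq (J K : ℕ) : Set (Schedule J) := {s | ∑ j, s j = K}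

/-- `φ j s` is the service quantum per slot offered to each scheduled class-`j` customer under
the schedule `s`; it is positive when class `j` is scheduled and `0` by convention otherwise. -/
def IsServiceQuantum (K : ℕ) (φ : Fin J → Schedule J → ℝ) : Prop :=
  ∀ s ∈ schedulesLE J K, ∀ j, (s j = 0 → φ j s = 0) ∧ (0 < s j → 0 < φ j s)

/-- The values that the residual service requirement of a class-`j` customer can take. -/
def residualValues (K : ℕ) (S : Fin J → ℝ) (φ : Fin J → Schedule J → ℝ) (j : Fin J) : Set ℝ :=
  {x | 0 < x ∧ ∃ l : List (Schedule J), (∀ s ∈ l, s ∈ schedulesLE J K ∧ 0 < s j) ∧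
    x = S j - (l.map (φ j)).sum}

/-- The countable set of all state vectors. -/
def stateVectors (K : ℕ) (S : Fin J → ℝ) (φ : Fin J → Schedule J → ℝ) : Set (State J) :=
  {α | ∀ j, ∀ x ∈ α j, x ∈ residualValues K S φ j}

/-- The state after serving the schedule `s` in state `α` and then admitting `a j` new class-`j`
customers: the first `s j` customers of queue `j` each receive `φ j s`, and leave when this
equals or exceeds their residual requirement. -/
def next (S : Fin J → ℝ) (φ : Fin J → Schedule J → ℝ) (α : State J) (s a : Fin J → ℕ) :
    State J := fun j =>
  (((α j).take (s j)).map (fun x => x - φ j s)).filter (fun x => decide (0 < x))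
    ++ (α j).drop (s j) ++ List.replicate (a j) (S j)

/-- The law of the vector of batch sizes in a slot: independent, with marginals `p j`. -/
def arrivals (p : Fin J → PMF ℕ) : PMF (Fin J → ℕ) :=
  (Measure.pi fun j => (p j).toMeasure).toPMF

/-- The mean batch size `𝔼 A_j` of an arrival law. -/
def meanArrivals (q : PMF ℕ) : ℝ := ∑' k : ℕ, (k : ℝ) * (q k).toReal

/-- The batch size has a finite second moment (and hence a finite mean). -/
def HasSecondMoment (q : PMF ℕ) : Prop := Summable fun k : ℕ => (k : ℝ) ^ 2 * (q k).toReal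

/-- Transition probabilities under the stationary randomized policy `ω`: draw a schedule from
`ω α`, draw the arrivals independently, and move to the next state. -/
def kernel (S : Fin J → ℝ) (φ : Fin J → Schedule J → ℝ) (p : Fin J → PMF ℕ)
    (ω : State J → PMF (Schedule J)) (α : State J) : PMF (State J) :=
  (ω α).bind fun s => (arrivals p).map fun a => next S φ α s a

/-- The class `Ω_K` of non-idling policies: only feasible schedules serving at most `K` customers
are used, and exactly `K` customers are served whenever at least `K` are present. -/
structure IsNonIdling (K : ℕ) (ω : State J → PMF (Schedule J)) : Prop where
  feasible : ∀ α, ∀ s ∈ (ω α).support, s ∈ schedulesLE J K ∧ ∀ j, s j ≤ (α j).length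
  nonIdling : ∀ α, K ≤ numCustomers α → ∀ s ∈ (ω α).support, s ∈ schedulesEq J K

/-- `φ̲_j`: the minimum of `φ j s` over schedules of exactly `K` customers with `s j > 0`. -/
def minQuantum (K : ℕ) (φ : Fin J → Schedule J → ℝ) (j : Fin J) : ℝ :=
  sInf (φ j '' {s | s ∈ schedulesEq J K ∧ 0 < s j})

/-- `φ̄_j`: the maximum of `φ j s` over schedules of at most `K` customers. -/
def maxQuantum (K : ℕ) (φ : Fin J → Schedule J → ℝ) (j : Fin J) : ℝ :=
  sSup (φ j '' schedulesLE J K)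

/-- The minimum over schedules `s` of exactly `K` customers of `∑_j s_j φ_j(s)`. -/
def minTotalQuantum (K : ℕ) (φ : Fin J → Schedule J → ℝ) : ℝ :=
  sInf ((fun s => ∑ j, (s j : ℝ) * φ j s) '' schedulesEq J K)

/-- The maximum over schedules `s` of exactly `K` customers of `∑_{j ∈ B} s_j φ_j(s)`. -/
def maxTotalQuantum (K : ℕ) (φ : Fin J → Schedule J → ℝ) (B : Finset (Fin J)) : ℝ :=
  sSup ((fun s => ∑ j ∈ B, (s j : ℝ) * φ j s) '' schedulesEq J K)

/-- `c(α) = 1 + ∑_j ∑_k ⌈x_j(k) / φ̲_j⌉`. -/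
def slotCost (K : ℕ) (φ : Fin J → Schedule J → ℝ) (α : State J) : ℝ≥0∞ :=
  ((1 + ∑ j, ((α j).map fun x => ⌈x / minQuantum K φ j⌉₊).sum : ℕ) : ℝ≥0∞)

/-- `c(α) = 1 + ∑_j ∑_k (x_j(k) + φ̄_j)`. -/
def workCost (K : ℕ) (φ : Fin J → Schedule J → ℝ) (α : State J) : ℝ≥0∞ :=
  ENNReal.ofReal (1 + ∑ j, ((α j).map fun x => x + maxQuantum K φ j).sum)

/-- The queue with (irreducible) state space `C` is stable: the chain is positive recurrent and
the number of customers has finite mean under the stationary distribution. -/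
def IsStable (P : State J → PMF (State J)) (C : Set (State J)) : Prop :=
  (∀ α ∈ C, IsPositiveRecurrentState P α) ∧
    ∃ π : PMF (State J), IsStationaryOn P C π ∧ ∑' α, π α * (numCustomers α : ℝ≥0∞) < ⊤

/-- The queue with state space `C` is unstable: the chain is transient. -/
def IsUnstable (P : State J → PMF (State J)) (C : Set (State J)) : Prop :=
  ∀ α ∈ C, IsTransientState P α

/-- From every state in `C`, states with arbitrarily many customers are accessible. -/
def ReachesArbitrarilyMany (P : State J → PMF (State J)) (C : Set (State J)) : Prop :=
  ∀ α ∈ C, ∀ N : ℕ, ∃ β, Accessible P α β ∧ N ≤ numCustomers β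

/-! ### Service quanta arising from independent decoding -/

/-- The quantum for independent Gaussian encoding with received powers `Pw j` and noise power
`N₀W = noise`. -/
def gaussianQuantum (ρ noise : ℝ) (Pw : Fin J → ℝ) (j : Fin J) (s : Schedule J) : ℝ :=
  if s j = 0 then 0
  else ρ * Real.log (1 + Pw j / ((1 + ρ) * ((∑ k, (s k : ℝ) * Pw k) - Pw j + noise)))

theorem gaussianQuantum_isServiceQuantum (K : ℕ) {ρ noise : ℝ} {Pw : Fin J → ℝ} (hρ : 0 < ρ)
    (hnoise : 0 < noise) (hPw : ∀ j, 0 < Pw j) :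
    IsServiceQuantum K (gaussianQuantum ρ noise Pw) := by
  intro s _ j
  refine ⟨fun h => by simp [gaussianQuantum, h], fun h => ?_⟩
  have h1 : Pw j ≤ ∑ k, (s k : ℝ) * Pw k := by
    have h2 : (s j : ℝ) * Pw j ≤ ∑ k, (s k : ℝ) * Pw k :=
      Finset.single_le_sum (f := fun k => (s k : ℝ) * Pw k)
        (fun k _ => mul_nonneg (Nat.cast_nonneg _) (hPw k).le) (Finset.mem_univ j)
    have h3 : (1 : ℝ) ≤ s j := by exact_mod_cast h
    nlinarith [hPw j]
  have h4 : 0 < (∑ k, (s k : ℝ) * Pw k) - Pw j + noise := by linarith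
  rw [gaussianQuantum, if_neg h.ne']
  have h5 : 0 < Pw j / ((1 + ρ) * ((∑ k, (s k : ℝ) * Pw k) - Pw j + noise)) := by
    have := hPw j
    positivity
  exact mul_pos hρ (Real.log_pos (by linarith))

/-- Multiaccess channels for every schedule, with letter distributions for random coding:
`law s x` is the output law when the vector input under schedule `s` is `x`. -/
structure MultiaccessChannel (J : ℕ) (𝒳 : Fin J → Type*) (𝒴 : Type*) where
  law : ∀ s : Schedule J, (∀ j, Fin (s j) → 𝒳 j) → PMF 𝒴
  input : ∀ j, PMF (𝒳 j)

open Classical in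
/-- The effective channel `p_j^s(y | x)` seen by the first class-`j` message under schedule `s`,
all the other inputs being random. -/
def MultiaccessChannel.effective {𝒳 : Fin J → Type*} {𝒴 : Type*} [∀ j, Fintype (𝒳 j)]
    (M : MultiaccessChannel J 𝒳 𝒴) (j : Fin J) (s : Schedule J) (h : 0 < s j)
    (x : 𝒳 j) (y : 𝒴) : ℝ :=
  ∑ z : (∀ l, Fin (s l) → 𝒳 l), if z j ⟨0, h⟩ = x then
    (M.law s z y).toReal * ∏ l, ∏ k : Fin (s l),
      (if l = j ∧ (k : ℕ) = 0 then 1 else (M.input l (z l k)).toReal)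
  else 0

/-- The random-coding exponent `E_{o,j}^s(ρ, Q_j)` of the effective channel, which is the service
quantum of a discrete memoryless multiaccess channel with independent decoding. -/
def MultiaccessChannel.quantum {𝒳 : Fin J → Type*} {𝒴 : Type*} [∀ j, Fintype (𝒳 j)] [Fintype 𝒴]
    (M : MultiaccessChannel J 𝒳 𝒴) (ρ : ℝ) (j : Fin J) (s : Schedule J) : ℝ :=
  if h : 0 < s j then
    -Real.log (∑ y, (∑ x, (M.input j x).toReal * M.effective j s h x y ^ (1 / (1 + ρ))) ^ (1 + ρ))
  else 0

theorem MultiaccessChannel.quantum_isServiceQuantum {𝒳 : Fin J → Type*} {𝒴 : Type*}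
    [∀ j, Fintype (𝒳 j)] [Fintype 𝒴] (M : MultiaccessChannel J 𝒳 𝒴) (ρ : ℝ) (K : ℕ)
    (hpos : ∀ s ∈ schedulesLE J K, ∀ j, 0 < s j → 0 < M.quantum ρ j s) :
    IsServiceQuantum K (M.quantum ρ) := fun s hs j =>
  ⟨fun h => by simp [MultiaccessChannel.quantum, h], hpos s hs j⟩

end Queue

end

/-! Every bound comes from one additive functional, `load w`, the sum of weights `w j x` over the
customers present. In a slot it gains `∑ w j (S j) * a j` from arrivals, with mean `m`, and loses
what service removes. Only states with fewer than `K` customers escape the non-idling rule, and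
there the load is bounded; above some level, exactly `K` customers are served.

If full service removes at least `d > m`, the squared load has drift at most `-2(d - m) * load +
const`, by the second moments. Finitely many states lie below any load level, so Foster's criterion
bounds the `c`-cost of reaching any state (`exists_expectedCost_le`); regularity follows, and
occupation times of an excursion give the stationary law (`exists_stationary`). If full service
removes at most `D < m`, then `1 / (1 + load)` is superharmonic at large loads, and transience
follows once larger loads are accessible (`isTransientState_of_superharmonic`).

The weights decide the bounds. Counting slots at the minimal quantum makes each service remove at
least one unit, and exactly one when the full schedule containing a given class is unique (`K = 1`
or `J = 1`). Residual work plus a constant absorbs the unused part of the last quantum; residual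
work of the classes in `B` alone gives the outer bound.

For Gaussian encoding, `log (1 + x) ≈ x` and `∑ s j * Pw j` is the total power, so the powers cancel
from the total quantum, which tends to `ρ / (1 + ρ)`, while each single quantum tends to `0`. -/

noncomputable section

/-! ### Expectations under a probability mass function -/

namespace MarkovChain

variable {X Y : Type*}

/-- The expectation of a nonnegative function under a probability mass function. -/
def expect (q : PMF X) (f : X → ℝ≥0∞) : ℝ≥0∞ := ∑' x, q x * f x

theorem expect_mono {q : PMF X} {f g : X → ℝ≥0∞} (h : ∀ x, q x ≠ 0 → f x ≤ g x) :
    expect q f ≤ expect q g := by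
  refine ENNReal.tsum_le_tsum fun x => ?_
  by_cases hx : q x = 0
  · simp [hx]
  · gcongr
    exact h x hx

theorem expect_const (q : PMF X) (c : ℝ≥0∞) : expect q (fun _ => c) = c := by
  simp [expect, ENNReal.tsum_mul_right, q.tsum_coe]

theorem expect_add (q : PMF X) (f g : X → ℝ≥0∞) :
    expect q (fun x => f x + g x) = expect q f + expect q g := by
  simp [expect, mul_add, ENNReal.tsum_add]

theorem expect_const_mul (q : PMF X) (c : ℝ≥0∞) (f : X → ℝ≥0∞) :
    expect q (fun x => c * f x) = c * expect q f := by
  simp [expect, mul_left_comm _ c, ENNReal.tsum_mul_left]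

theorem expect_tsum (q : PMF X) {ι : Type*} (f : ι → X → ℝ≥0∞) :
    expect q (fun x => ∑' i, f i x) = ∑' i, expect q (f i) := by
  simp only [expect, ← ENNReal.tsum_mul_left]
  exact ENNReal.tsum_comm

theorem expect_finset_sum (q : PMF X) {ι : Type*} (t : Finset ι) (f : ι → X → ℝ≥0∞) :
    expect q (fun x => ∑ i ∈ t, f i x) = ∑ i ∈ t, expect q (f i) := by
  classical
  induction t using Finset.induction_on with
  | empty => simp [expect]
  | insert i t hi ih => simp [Finset.sum_insert hi, expect_add, ih]

theorem expect_bind (q : PMF X) (g : X → PMF Y) (f : Y → ℝ≥0∞) :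
    expect (q.bind g) f = expect q (fun x => expect (g x) f) := by
  simp only [expect, PMF.bind_apply, ← ENNReal.tsum_mul_left, ← ENNReal.tsum_mul_right]
  rw [ENNReal.tsum_comm]
  simp only [mul_assoc]

theorem expect_pure (x : X) (f : X → ℝ≥0∞) : expect (PMF.pure x) f = f x := by
  rw [expect, tsum_eq_single x]
  · simp
  · intro y hy
    simp [PMF.pure_apply, hy]

theorem expect_map (q : PMF X) (g : X → Y) (f : Y → ℝ≥0∞) :
    expect (q.map g) f = expect q (fun x => f (g x)) := by
  rw [← PMF.bind_pure_comp, expect_bind]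
  simp [expect_pure]

theorem le_expect (q : PMF X) (f : X → ℝ≥0∞) (x : X) : q x * f x ≤ expect q f :=
  ENNReal.le_tsum (f := fun x => q x * f x) x

/-! ### The chain killed on a set -/

open Classical in
/-- The function `f` killed on `Y`. -/
def kill (Y : Set X) (f : X → ℝ≥0∞) (β : X) : ℝ≥0∞ := if β ∈ Y then 0 else f β

theorem avoid_succ (P : X → PMF X) (Y : Set X) (c : X → ℝ≥0∞) (n : ℕ) (α : X) :
    avoid P Y c (n + 1) α = expect (P α) (kill Y (avoid P Y c n)) := rfl

theorem kill_le (Y : Set X) (f : X → ℝ≥0∞) (β : X) : kill Y f β ≤ f β := by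
  unfold kill; split_ifs <;> simp

theorem kill_mono (Y : Set X) {f g : X → ℝ≥0∞} {β : X} (h : f β ≤ g β) :
    kill Y f β ≤ kill Y g β := by
  unfold kill; split_ifs <;> simp [h]

theorem kill_add (Y : Set X) (f g : X → ℝ≥0∞) (β : X) :
    kill Y (fun x => f x + g x) β = kill Y f β + kill Y g β := by
  unfold kill; split_ifs <;> simp

theorem kill_const_mul (Y : Set X) (c : ℝ≥0∞) (f : X → ℝ≥0∞) (β : X) :
    kill Y (fun x => c * f x) β = c * kill Y f β := by
  unfold kill; split_ifs <;> simp

theorem kill_tsum (Y : Set X) {ι : Type*} (f : ι → X → ℝ≥0∞) (β : X) :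
    kill Y (fun x => ∑' i, f i x) β = ∑' i, kill Y (f i) β := by
  unfold kill; split_ifs <;> simp

theorem kill_finset_sum (Y : Set X) {ι : Type*} (t : Finset ι) (f : ι → X → ℝ≥0∞) (β : X) :
    kill Y (fun x => ∑ i ∈ t, f i x) β = ∑ i ∈ t, kill Y (f i) β := by
  unfold kill; split_ifs <;> simp

/-- Peeling off the last step instead of the first moves the transition onto the cost. This yields
the shift identity `expectedCost_eq_add` and the monotonicity in time of the survival probability.
-/
theorem avoid_succ' (P : X → PMF X) (Y : Set X) (c : X → ℝ≥0∞) (n : ℕ) :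
    avoid P Y c (n + 1) = avoid P Y (fun α => expect (P α) (kill Y c)) n := by
  induction n with
  | zero => rfl
  | succ n ih =>
    funext α
    rw [avoid_succ, ih, avoid_succ]

theorem avoid_anti (P : X → PMF X) {Y Z : Set X} (h : Y ⊆ Z) (c : X → ℝ≥0∞) (n : ℕ) (α : X) :
    avoid P Z c n α ≤ avoid P Y c n α := by
  induction n generalizing α with
  | zero => exact le_rfl
  | succ n ih =>
    rw [avoid_succ, avoid_succ]
    refine expect_mono fun β _ => ?_
    unfold kill
    by_cases hZ : β ∈ Z
    · simp [hZ]
    · have hY : β ∉ Y := fun hY => hZ (h hY)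
      simp [hZ, hY, ih β]

theorem avoid_mono {P : X → PMF X} {C : Set X} (hC : IsClosedSet P C) (Y : Set X)
    {c d : X → ℝ≥0∞} (h : ∀ x ∈ C, c x ≤ d x) (n : ℕ) {α : X} (hα : α ∈ C) :
    avoid P Y c n α ≤ avoid P Y d n α := by
  induction n generalizing α with
  | zero => exact h α hα
  | succ n ih => exact expect_mono fun β hβ => kill_mono Y (ih (hC α hα β hβ))

theorem avoid_add (P : X → PMF X) (Y : Set X) (c d : X → ℝ≥0∞) (n : ℕ) (α : X) :
    avoid P Y (fun x => c x + d x) n α = avoid P Y c n α + avoid P Y d n α := by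
  induction n generalizing α with
  | zero => rfl
  | succ n ih =>
    simp only [avoid_succ]
    rw [← expect_add]
    congr 1
    funext β
    rw [← kill_add]
    exact congrArg (fun f => kill Y f β) (funext ih)

theorem avoid_const_mul (P : X → PMF X) (Y : Set X) (a : ℝ≥0∞) (c : X → ℝ≥0∞) (n : ℕ) (α : X) :
    avoid P Y (fun x => a * c x) n α = a * avoid P Y c n α := by
  induction n generalizing α with
  | zero => rfl
  | succ n ih =>
    simp only [avoid_succ]
    rw [← expect_const_mul]
    congr 1
    funext β
    rw [← kill_const_mul]
    exact congrArg (fun f => kill Y f β) (funext ih)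

theorem avoid_tsum (P : X → PMF X) (Y : Set X) {ι : Type*} (c : ι → X → ℝ≥0∞) (n : ℕ) (α : X) :
    avoid P Y (fun x => ∑' i, c i x) n α = ∑' i, avoid P Y (c i) n α := by
  induction n generalizing α with
  | zero => rfl
  | succ n ih =>
    simp only [avoid_succ]
    rw [← expect_tsum]
    congr 1
    funext β
    rw [← kill_tsum]
    exact congrArg (fun f => kill Y f β) (funext ih)

theorem avoid_one_le (P : X → PMF X) (Y : Set X) (n : ℕ) (α : X) :
    avoid P Y (fun _ => 1) n α ≤ 1 := by
  induction n generalizing α with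
  | zero => exact le_rfl
  | succ n ih =>
    calc _ ≤ expect (P α) (fun _ => 1) :=
          expect_mono fun β _ => (kill_le Y _ β).trans (ih β)
      _ = 1 := expect_const _ _

theorem expectedCost_anti (P : X → PMF X) {Y Z : Set X} (h : Y ⊆ Z) (c : X → ℝ≥0∞) (α : X) :
    expectedCost P Z c α ≤ expectedCost P Y c α :=
  ENNReal.tsum_le_tsum fun n => avoid_anti P h c n α

theorem expectedCost_mono {P : X → PMF X} {C : Set X} (hC : IsClosedSet P C) (Y : Set X)
    {c d : X → ℝ≥0∞} (h : ∀ x ∈ C, c x ≤ d x) {α : X} (hα : α ∈ C) :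
    expectedCost P Y c α ≤ expectedCost P Y d α :=
  ENNReal.tsum_le_tsum fun n => avoid_mono hC Y h n hα

theorem expectedCost_const_mul (P : X → PMF X) (Y : Set X) (a : ℝ≥0∞) (c : X → ℝ≥0∞) (α : X) :
    expectedCost P Y (fun x => a * c x) α = a * expectedCost P Y c α := by
  simp only [expectedCost, avoid_const_mul, ENNReal.tsum_mul_left]

/-! ### Comparison and Foster's criterion -/

/-- The comparison theorem: a nonnegative supersolution of the first-step equation dominates the
expected cost. -/
theorem expectedCost_le_of_supersolution {P : X → PMF X} {C : Set X} (hC : IsClosedSet P C)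
    {Y : Set X} {c W : X → ℝ≥0∞} (hW : ∀ α ∈ C, c α + expect (P α) (kill Y W) ≤ W α) {α : X}
    (hα : α ∈ C) : expectedCost P Y c α ≤ W α := by
  refine ENNReal.tsum_le_of_sum_range_le fun N => ?_
  induction N generalizing α with
  | zero => simp
  | succ N ih =>
    rw [Finset.sum_range_succ']
    simp only [avoid_succ]
    rw [← expect_finset_sum, add_comm]
    refine le_trans (add_le_add le_rfl (expect_mono fun β hβ => ?_)) (hW α hα)
    rw [← kill_finset_sum]
    exact kill_mono Y (ih (hC α hα β hβ))

/-- The expectation of `1 - 2 ^ (-τ_Y)`. -/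
def discountedAvoid (P : X → PMF X) (Y : Set X) (α : X) : ℝ≥0∞ :=
  ∑' n : ℕ, (2⁻¹ : ℝ≥0∞) ^ (n + 1) * avoid P Y (fun _ => 1) n α

theorem discountedAvoid_le_one (P : X → PMF X) (Y : Set X) (α : X) :
    discountedAvoid P Y α ≤ 1 := by
  calc discountedAvoid P Y α ≤ ∑' n : ℕ, (2⁻¹ : ℝ≥0∞) ^ (n + 1) :=
        ENNReal.tsum_le_tsum fun n => mul_le_of_le_one_right' (avoid_one_le P Y n α)
    _ = 1 := by
      rw [ENNReal.tsum_geometric_add_one, ENNReal.one_sub_inv_two, inv_inv]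
      exact ENNReal.inv_mul_cancel (by simp) (by simp)

theorem discountedAvoid_eq (P : X → PMF X) (Y : Set X) (α : X) :
    discountedAvoid P Y α = 2⁻¹ + 2⁻¹ * expect (P α) (kill Y (discountedAvoid P Y)) := by
  have h : kill Y (discountedAvoid P Y) =
      fun β => ∑' n : ℕ, (2⁻¹ : ℝ≥0∞) ^ (n + 1) * kill Y (avoid P Y (fun _ => 1) n) β := by
    funext β
    simp only [← kill_const_mul, ← kill_tsum]
    rfl
  rw [h, expect_tsum, ← ENNReal.tsum_mul_left, discountedAvoid,
    tsum_eq_zero_add' ENNReal.summable]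
  congr 1
  · simp [avoid]
  · refine tsum_congr fun n => ?_
    rw [expect_const_mul, avoid_succ, pow_succ' _ (n + 1), mul_assoc]

/-- Solving `h = 1/2 + (1/2) P h` for the killed expectation `P h` gives `P h = 2h - 1`, so the
killed drift of `h` is exactly `-(1 - h)`. The additive form avoids truncated subtraction. -/
theorem discountedAvoid_add (P : X → PMF X) (Y : Set X) (α : X) :
    expect (P α) (kill Y (discountedAvoid P Y)) + (1 - discountedAvoid P Y α)
      = discountedAvoid P Y α := by
  have h1 := discountedAvoid_le_one P Y α
  have h2 : expect (P α) (kill Y (discountedAvoid P Y)) ≤ 1 := by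
    calc _ ≤ expect (P α) (fun _ => 1) :=
          expect_mono fun β _ => (kill_le Y _ β).trans (discountedAvoid_le_one P Y β)
      _ = 1 := expect_const _ _
  have h3 := discountedAvoid_eq P Y α
  lift discountedAvoid P Y α to NNReal using ne_top_of_le_ne_top (by simp) h1 with t
  lift expect (P α) (kill Y (discountedAvoid P Y)) to NNReal using
    ne_top_of_le_ne_top (by simp) h2 with e
  have h4 : t = 2⁻¹ + 2⁻¹ * e := by
    have : (2⁻¹ : ℝ≥0∞) = ((2⁻¹ : NNReal) : ℝ≥0∞) := by simp
    rw [this] at h3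
    exact_mod_cast h3
  have h5 : t ≤ 1 := by exact_mod_cast h1
  have h6 : e + (1 - t) = t := by
    apply NNReal.eq
    rw [NNReal.coe_add, NNReal.coe_sub h5, h4]
    push_cast
    ring
  exact_mod_cast h6

/-- A maximum principle: where `h = 1`, its killed mean is `1`, so every successor differs from `y`
and again has `h = 1`. This would propagate along a path to `y` itself. -/
theorem discountedAvoid_lt_one {P : X → PMF X} {C : Set X} (hC : IsIrreducibleOn P C) {y : X}
    (hy : y ∈ C) {α : X} (hα : α ∈ C) : discountedAvoid P {y} α < 1 := by
  have step : ∀ γ δ, discountedAvoid P {y} γ = 1 → P γ δ ≠ 0 →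
      δ ≠ y ∧ discountedAvoid P {y} δ = 1 := by
    intro γ δ hγ hγδ
    have h1 := discountedAvoid_add P {y} γ
    rw [hγ, tsub_self, add_zero] at h1
    have hk : kill {y} (discountedAvoid P {y}) δ = 1 := by
      by_contra hne
      have hle : ∀ β, kill {y} (discountedAvoid P {y}) β ≤ 1 := fun β =>
        (kill_le _ _ β).trans (discountedAvoid_le_one P _ β)
      have hlt := lt_of_le_of_ne (hle δ) hne
      have : expect (P γ) (kill {y} (discountedAvoid P {y})) < expect (P γ) (fun _ => 1) := by
        refine ENNReal.tsum_lt_tsum (i := δ) ?_ (fun β => ?_) ?_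
        · exact (ne_of_lt (by rw [← expect, h1]; simp))
        · gcongr; exact hle β
        · exact ENNReal.mul_lt_mul_right hγδ ((P γ).apply_ne_top δ) hlt
      rw [h1, expect_const] at this
      exact lt_irrefl _ this
    unfold kill at hk
    split_ifs at hk with h
    · simp at hk
    · exact ⟨h, hk⟩
  refine lt_of_le_of_ne (discountedAvoid_le_one P _ α) fun h => ?_
  obtain ⟨β, hβ⟩ := (P α).support_nonempty
  have hβC := hC.closed α hα β hβ
  have key : ∀ δ, Accessible P β δ → δ ≠ y ∧ discountedAvoid P {y} δ = 1 := by
    intro δ hδ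
    induction hδ with
    | refl => exact step α β h hβ
    | tail _ hs ih => exact step _ _ ih.2 hs
  exact (key y (hC.communicate β hβC y hy)).1 rfl

/-- Foster's criterion with a finite exceptional set. -/
theorem exists_expectedCost_le {P : X → PMF X} {C : Set X} (hC : IsIrreducibleOn P C)
    {V c : X → ℝ≥0∞} {F : Set X} (hF : (C ∩ F).Finite) {b : ℝ≥0∞} (hb : b ≠ ⊤)
    (hdrift : ∀ α ∈ C, α ∉ F → expect (P α) V + c α ≤ V α)
    (hdrift' : ∀ α ∈ C, α ∈ F → expect (P α) V + c α ≤ V α + b) {y : X} (hy : y ∈ C) :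
    ∃ B : ℝ≥0∞, B ≠ ⊤ ∧ ∀ α ∈ C, expectedCost P {y} c α ≤ V α + B := by
  -- `1 - discountedAvoid` is positive at each of finitely many states, hence bounded below on the
  -- exceptional set.
  obtain ⟨δ, hδ0, hδ⟩ : ∃ δ : ℝ≥0∞, δ ≠ 0 ∧ ∀ α ∈ C ∩ F, δ ≤ 1 - discountedAvoid P {y} α := by
    rcases (C ∩ F).eq_empty_or_nonempty with h | h
    · exact ⟨1, one_ne_zero, by simp [h]⟩
    · obtain ⟨α, hα, hmin⟩ := hF.exists_minimalFor (fun α => 1 - discountedAvoid P {y} α) _ h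
      refine ⟨1 - discountedAvoid P {y} α,
        (tsub_pos_of_lt (discountedAvoid_lt_one hC hy hα.1)).ne', fun β hβ => ?_⟩
      exact (le_total _ _).elim id fun h => hmin hβ h
  have hbδ : b / δ ≠ ⊤ := ENNReal.div_ne_top hb hδ0
  refine ⟨b / δ, hbδ, fun α hα => ?_⟩
  have hle : V α + b / δ * discountedAvoid P {y} α ≤ V α + b / δ := by
    gcongr
    exact mul_le_of_le_one_right' (discountedAvoid_le_one P {y} α)
  -- The added term has killed drift `-(b / δ) * (1 - discountedAvoid)`, which is at most `-b` on
  -- `F` and pays for the excess there; elsewhere it does no harm.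
  refine le_trans (expectedCost_le_of_supersolution hC.closed
    (W := fun x => V x + b / δ * discountedAvoid P {y} x) (fun β hβ => ?_) hα) hle
  have h1 : expect (P β) (kill {y} fun x => V x + b / δ * discountedAvoid P {y} x) ≤
      expect (P β) V + b / δ * expect (P β) (kill {y} (discountedAvoid P {y})) := by
    rw [← expect_const_mul, ← expect_add]
    refine expect_mono fun γ _ => ?_
    rw [kill_add, kill_const_mul]
    gcongr
    exact kill_le _ _ _
  have h2 : expect (P β) V + c β ≤ V β + b / δ * (1 - discountedAvoid P {y} β) := by
    by_cases hβF : β ∈ F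
    · refine (hdrift' β hβ hβF).trans ?_
      gcongr
      calc b ≤ b / δ * δ := by
            rw [ENNReal.div_mul_cancel hδ0]
            exact ne_top_of_le_ne_top (by simp) ((hδ β ⟨hβ, hβF⟩).trans tsub_le_self)
        _ ≤ _ := by gcongr; exact hδ β ⟨hβ, hβF⟩
    · exact (hdrift β hβ hβF).trans le_self_add
  calc c β + expect (P β) (kill {y} fun x => V x + b / δ * discountedAvoid P {y} x)
      ≤ c β + (expect (P β) V + b / δ * expect (P β) (kill {y} (discountedAvoid P {y}))) := by
        gcongr
    _ = (expect (P β) V + c β) + b / δ * expect (P β) (kill {y} (discountedAvoid P {y})) := by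
        ring
    _ ≤ (V β + b / δ * (1 - discountedAvoid P {y} β))
          + b / δ * expect (P β) (kill {y} (discountedAvoid P {y})) := by gcongr
    _ = V β + b / δ * (expect (P β) (kill {y} (discountedAvoid P {y}))
          + (1 - discountedAvoid P {y} β)) := by ring
    _ = _ := by rw [discountedAvoid_add]

/-- Under Foster's criterion the chain is `c`-regular. -/
theorem isRegular_of_expectedCost_le {P : X → PMF X} {C : Set X} {V c : X → ℝ≥0∞}
    (hV : ∀ α ∈ C, V α ≠ ⊤)
    (h : ∀ y ∈ C, ∃ B : ℝ≥0∞, B ≠ ⊤ ∧ ∀ α ∈ C, expectedCost P {y} c α ≤ V α + B) :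
    IsRegular P C c := by
  refine ⟨fun i => {α ∈ C | V α ≤ i}, fun α hα => ?_, fun i => ⟨fun α hα => hα.1, ?_⟩⟩
  · obtain ⟨n, hn⟩ := ENNReal.exists_nat_gt (hV α hα)
    exact Set.mem_iUnion.2 ⟨n, hα, hn.le⟩
  · rintro Y hY ⟨y, hyY⟩
    obtain ⟨B, hB, hle⟩ := h y (hY hyY)
    refine lt_of_le_of_lt (iSup₂_le fun α hα => ?_)
      (ENNReal.add_lt_top.2 ⟨ENNReal.natCast_lt_top i, hB.lt_top⟩)
    exact ((expectedCost_anti P (Set.singleton_subset_iff.2 hyY) c α).trans (hle α hα.1)).trans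
      (by gcongr; exact hα.2)

/-! ### Excursions and stationary distributions -/

theorem expectedCost_eq_add (P : X → PMF X) (Y : Set X) (c : X → ℝ≥0∞) (α : X) :
    expectedCost P Y c α = c α + expectedCost P Y (fun α => expect (P α) (kill Y c)) α := by
  rw [expectedCost, tsum_eq_zero_add' ENNReal.summable]
  simp only [avoid_succ']
  rfl

theorem expectedCost_add (P : X → PMF X) (Y : Set X) (c d : X → ℝ≥0∞) (α : X) :
    expectedCost P Y (fun x => c x + d x) α = expectedCost P Y c α + expectedCost P Y d α := by
  simp only [expectedCost, avoid_add, ENNReal.tsum_add]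

theorem expectedCost_zero (P : X → PMF X) (Y : Set X) (α : X) :
    expectedCost P Y (fun _ => 0) α = 0 := by
  simpa using expectedCost_const_mul P Y 0 (fun _ => 0) α

theorem expectedCost_tsum (P : X → PMF X) (Y : Set X) {ι : Type*} (c : ι → X → ℝ≥0∞) (α : X) :
    expectedCost P Y (fun x => ∑' i, c i x) α = ∑' i, expectedCost P Y (c i) α := by
  simp only [expectedCost, avoid_tsum]
  exact ENNReal.tsum_comm

/-- The expected number of visits to `β` during an excursion from `y`. -/
def occupation (P : X → PMF X) (y β : X) : ℝ≥0∞ :=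
  expectedCost P {y} (fun x => PMF.pure x β) y

theorem tsum_occupation_mul (P : X → PMF X) (y : X) (f : X → ℝ≥0∞) :
    ∑' β, occupation P y β * f β = expectedCost P {y} f y := by
  have h : f = fun x => ∑' β, f β * PMF.pure x β := by
    funext x
    simp [PMF.pure_apply]
  conv_rhs => rw [h]
  rw [expectedCost_tsum]
  refine tsum_congr fun β => ?_
  rw [expectedCost_const_mul, mul_comm]
  rfl

theorem expect_pure_apply (q : PMF X) (γ : X) : expect q (fun x => PMF.pure x γ) = q γ := by
  have := congrArg (fun r : PMF X => r γ) (PMF.bind_pure q)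
  simpa only [PMF.bind_apply, expect] using this

theorem occupation_self (P : X → PMF X) (y : X) : occupation P y y = 1 := by
  have h : (fun α => expect (P α) (kill {y} fun x => PMF.pure x y)) = fun _ => 0 := by
    funext α
    have : (kill {y} fun x => PMF.pure x y) = fun _ => 0 := by
      funext β
      by_cases hβ : β = y
      · simp [kill, hβ]
      · simp [kill, hβ, PMF.pure_apply, Ne.symm hβ]
    rw [this, expect_const]
  rw [occupation, expectedCost_eq_add, h, expectedCost_zero]
  simp

theorem tsum_occupation_mul_apply {P : X → PMF X} {y : X}
    (hy : expectedCost P {y} (fun _ => 1) y < ⊤) (γ : X) :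
    ∑' β, occupation P y β * P β γ = occupation P y γ := by
  rw [tsum_occupation_mul]
  by_cases hγ : γ = y
  · subst hγ
    rw [occupation_self]
    -- Each step either avoids `γ` or lands on it. Summed over the excursion, the avoiding part is
    -- the return time minus one, leaving exactly one landing.
    have h1 : (fun _ : X => (1 : ℝ≥0∞)) =
        fun α => expect (P α) (kill {γ} fun _ => 1) + P α γ := by
      funext α
      rw [← expect_pure_apply (P α) γ, ← expect_add]
      refine (expect_const (P α) 1).symm.trans ?_
      congr 1
      funext β
      by_cases hβ : β = γ
      · simp [kill, hβ]
      · simp [kill, hβ, PMF.pure_apply, Ne.symm hβ]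
    have h2 := expectedCost_eq_add P {γ} (fun _ => 1) γ
    have h3 := expectedCost_add P {γ} (fun α => expect (P α) (kill {γ} fun _ => 1))
      (fun α => P α γ) γ
    rw [← h1] at h3
    -- Cancellation in `ℝ≥0∞` requires finiteness: here the finite mean return time enters.
    have hfin : expectedCost P {γ} (fun α => expect (P α) (kill {γ} fun _ => 1)) γ ≠ ⊤ := by
      intro h
      rw [h2, h] at hy
      simp at hy
    rw [h3, add_comm] at h2
    exact (ENNReal.add_left_inj hfin).1 h2
  · have h1 : (fun α => P α γ) = fun α => expect (P α) (kill {y} fun x => PMF.pure x γ) := by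
      funext α
      rw [← expect_pure_apply (P α) γ]
      congr 1
      funext β
      by_cases hβ : β = y
      · simp [kill, hβ, PMF.pure_apply, hγ]
      · simp [kill, hβ]
    rw [h1, occupation, expectedCost_eq_add P {y} (fun x => PMF.pure x γ) y]
    simp [PMF.pure_apply, hγ]

theorem avoid_eq_zero {P : X → PMF X} {C : Set X} (hC : IsClosedSet P C) (Y : Set X)
    {c : X → ℝ≥0∞} (hc : ∀ x ∈ C, c x = 0) (n : ℕ) {α : X} (hα : α ∈ C) :
    avoid P Y c n α = 0 := by
  induction n generalizing α with
  | zero => exact hc α hα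
  | succ n ih =>
    rw [avoid_succ, ← nonpos_iff_eq_zero, ← expect_const (P α) 0]
    exact expect_mono fun β hβ => (kill_le _ _ _).trans (ih (hC α hα β hβ)).le

/-- A state with finite mean return time carries a stationary distribution, given by the
occupation times of an excursion. -/
theorem exists_stationary {P : X → PMF X} {C : Set X} (hC : IsClosedSet P C) {y : X}
    (hyC : y ∈ C) (hy : expectedCost P {y} (fun _ => 1) y < ⊤) :
    ∃ π : PMF X, IsStationaryOn P C π ∧
      ∀ f, ∑' α, π α * f α = (expectedCost P {y} (fun _ => 1) y)⁻¹ * expectedCost P {y} f y := by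
  have hsum : ∑' β, occupation P y β = expectedCost P {y} (fun _ => 1) y := by
    simpa using tsum_occupation_mul P y (fun _ => 1)
  have hne : expectedCost P {y} (fun _ => 1) y ≠ 0 := by
    rw [expectedCost_eq_add]
    simp
  let π : PMF X := ⟨fun β => (expectedCost P {y} (fun _ => 1) y)⁻¹ * occupation P y β, by
    have h := (ENNReal.summable
      (f := fun β => (expectedCost P {y} (fun _ => 1) y)⁻¹ * occupation P y β)).hasSum
    rwa [ENNReal.tsum_mul_left, hsum, ENNReal.inv_mul_cancel hne hy.ne] at h⟩
  have hπ : ∀ β, π β = (expectedCost P {y} (fun _ => 1) y)⁻¹ * occupation P y β := fun _ => rfl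
  refine ⟨π, ⟨fun β hβ => ?_, ?_⟩, fun f => ?_⟩
  · by_contra hβC
    refine hβ ?_
    have h0 : ∀ n, avoid P {y} (fun x => PMF.pure x β) n y = 0 := fun n =>
      avoid_eq_zero hC {y} (fun x hx => by
        have : β ≠ x := fun h => hβC (h ▸ hx)
        simp [PMF.pure_apply, this]) n hyC
    have h1 : occupation P y β = 0 := by simp only [occupation, expectedCost, h0, tsum_zero]
    rw [hπ, h1, mul_zero]
  · ext γ
    rw [PMF.bind_apply, hπ, ← tsum_occupation_mul_apply hy γ, ← ENNReal.tsum_mul_left]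
    simp only [hπ, mul_assoc]
  · rw [← tsum_occupation_mul P y f, ← ENNReal.tsum_mul_left]
    simp only [hπ, mul_assoc]

/-! ### Transience from a superharmonic function -/

/-- If the chain surely returns to `α`, no step of positive probability can lead to a state that may
miss `α`: the escape probability from `γ` is at least `P γ δ` times that from `δ`. -/
theorem iInf_avoid_eq_zero_of_accessible {P : X → PMF X} {α β : X}
    (h : ⨅ n, avoid P {α} (fun _ => 1) n α = 0) (hβ : Accessible P α β) :
    ⨅ n, avoid P {α} (fun _ => 1) n β = 0 := by
  induction hβ with
  | refl => exact h
  | @tail γ δ _ hs ih =>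
    by_cases hδ : δ = α
    · rw [hδ]; exact h
    by_contra hne
    have hpos := (ENNReal.mul_pos hs hne).ne'
    refine hpos (nonpos_iff_eq_zero.1 (ih ▸ le_iInf fun n => ?_))
    calc P γ δ * ⨅ n, avoid P {α} (fun _ => 1) n δ
        ≤ P γ δ * kill {α} (avoid P {α} (fun _ => 1) n) δ := by
          gcongr
          simp only [kill, Set.mem_singleton_iff, hδ, if_false]
          exact iInf_le _ n
      _ ≤ avoid P {α} (fun _ => 1) (n + 1) γ := le_expect _ _ _
      _ ≤ avoid P {α} (fun _ => 1) n γ := by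
          rw [avoid_succ']
          refine avoid_mono (C := Set.univ) (fun _ _ _ _ => trivial) _ (fun x _ => ?_) n trivial
          exact (expect_mono fun z _ => kill_le _ _ z).trans (expect_const (P x) 1).le

/-- A state is transient if some accessible state has a smaller value of a nonnegative
superharmonic function. -/
theorem isTransientState_of_superharmonic {P : X → PMF X} {C : Set X} (hC : IsClosedSet P C)
    {α β : X} (hα : α ∈ C) (hβ : Accessible P α β) {H : X → ℝ≥0∞}
    (hH : ∀ γ ∈ C, H γ < 1 → expect (P γ) H ≤ H γ) (hHα : 1 ≤ H α) (hHβ : H β < 1) :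
    IsTransientState P α := by
  refine pos_iff_ne_zero.2 fun h => ?_
  have h0 := iInf_avoid_eq_zero_of_accessible h hβ
  -- Finite-horizon form of "the probability of hitting `α` is at most `H`". Killing at `α` costs
  -- nothing since `1 ≤ H α`, and superharmonicity is needed only where `H < 1`.
  have key : ∀ n, ∀ γ ∈ C, 1 ≤ avoid P {α} (fun _ => 1) n γ + H γ := by
    intro n
    induction n with
    | zero => intro γ _; exact le_self_add
    | succ n ih =>
      intro γ hγ
      rcases lt_or_ge (H γ) 1 with hlt | hge
      · refine le_trans ?_ (add_le_add le_rfl (hH γ hγ hlt))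
        rw [avoid_succ, ← expect_add]
        refine (expect_const (P γ) 1).symm.le.trans (expect_mono fun δ hδ => ?_)
        by_cases hδα : δ = α
        · exact le_add_left (hδα ▸ hHα)
        · simpa [kill, hδα] using ih δ (hC γ hγ δ hδ)
      · exact le_add_left hge
  have hβC : β ∈ C := by
    clear h0 hHβ h
    induction hβ with
    | refl => exact hα
    | tail _ hs ih => exact hC _ ih _ hs
  have : 1 - H β ≤ ⨅ n, avoid P {α} (fun _ => 1) n β :=
    le_iInf fun n => tsub_le_iff_right.2 (key n β hβC)
  rw [h0] at this
  exact absurd (nonpos_iff_eq_zero.1 this) (tsub_pos_of_lt hHβ).ne'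

end MarkovChain

namespace Queue

open MarkovChain

variable {J : ℕ}

/-! #### Arrivals -/

theorem expect_eq_lintegral {Y : Type*} [Countable Y] [MeasurableSpace Y]
    [MeasurableSingletonClass Y] (q : PMF Y) (f : Y → ℝ≥0∞) :
    expect q f = ∫⁻ x, f x ∂q.toMeasure := by
  rw [lintegral_countable']
  refine tsum_congr fun x => ?_
  rw [q.toMeasure_apply_singleton x (measurableSet_singleton x), mul_comm]

theorem expect_arrivals_eval (p : Fin J → PMF ℕ) (j : Fin J) (f : ℕ → ℝ≥0∞) :
    expect (arrivals p) (fun a => f (a j)) = expect (p j) f := by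
  rw [expect_eq_lintegral, expect_eq_lintegral, arrivals, Measure.toPMF_toMeasure]
  exact (measurePreserving_eval (fun j => (p j).toMeasure) j).lintegral_comp
    (measurable_from_top (f := f))

theorem HasSecondMoment.summable_mean {q : PMF ℕ} (hq : HasSecondMoment q) :
    Summable fun k : ℕ => (k : ℝ) * (q k).toReal := by
  refine Summable.of_nonneg_of_le (fun k => by positivity) (fun k => ?_) hq
  gcongr
  exact_mod_cast Nat.le_self_pow two_ne_zero k

theorem meanArrivals_nonneg (q : PMF ℕ) : 0 ≤ meanArrivals q :=
  tsum_nonneg fun _ => by positivity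

theorem expect_eq_ofReal_tsum {Y : Type*} (q : PMF Y) {f : Y → ℝ} (hf : ∀ k, 0 ≤ f k)
    (hs : Summable fun k => f k * (q k).toReal) :
    expect q (fun k => ENNReal.ofReal (f k)) = ENNReal.ofReal (∑' k, f k * (q k).toReal) := by
  rw [ENNReal.ofReal_tsum_of_nonneg (fun k => mul_nonneg (hf k) ENNReal.toReal_nonneg) hs]
  refine tsum_congr fun k => ?_
  rw [ENNReal.ofReal_mul (hf k), ENNReal.ofReal_toReal (q.apply_ne_top k), mul_comm]

/-- The mean of a weighted number of arrivals. -/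
theorem expect_arrivals_sum {p : Fin J → PMF ℕ} (hp : ∀ j, HasSecondMoment (p j)) {c : Fin J → ℝ}
    (hc : ∀ j, 0 ≤ c j) :
    expect (arrivals p) (fun a => ENNReal.ofReal (∑ j, c j * a j))
      = ENNReal.ofReal (∑ j, meanArrivals (p j) * c j) := by
  have h1 : (fun a : Fin J → ℕ => ENNReal.ofReal (∑ j, c j * a j)) =
      fun a => ∑ j, ENNReal.ofReal (c j) * ENNReal.ofReal (a j : ℝ) := by
    funext a
    rw [ENNReal.ofReal_sum_of_nonneg fun j _ => mul_nonneg (hc j) (Nat.cast_nonneg _)]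
    exact Finset.sum_congr rfl fun j _ => ENNReal.ofReal_mul (hc j)
  rw [h1, expect_finset_sum, ENNReal.ofReal_sum_of_nonneg fun j _ =>
    mul_nonneg (meanArrivals_nonneg _) (hc j)]
  refine Finset.sum_congr rfl fun j _ => ?_
  rw [expect_const_mul, expect_arrivals_eval p j fun k => ENNReal.ofReal (k : ℝ),
    expect_eq_ofReal_tsum (p j) (fun k => Nat.cast_nonneg k) (hp j).summable_mean, mul_comm,
    ENNReal.ofReal_mul (meanArrivals_nonneg _)]
  rfl

/-- Cauchy–Schwarz reduces the square of the sum to the second moments of the marginals. -/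
theorem expect_arrivals_sum_sq {p : Fin J → PMF ℕ} (hp : ∀ j, HasSecondMoment (p j))
    (c : Fin J → ℝ) :
    expect (arrivals p) (fun a => ENNReal.ofReal ((∑ j, c j * a j) ^ 2)) ≠ ⊤ := by
  have h1 : ∀ a : Fin J → ℕ, ENNReal.ofReal ((∑ j, c j * a j) ^ 2) ≤
      ∑ j, ENNReal.ofReal (J * c j ^ 2) * ENNReal.ofReal ((a j : ℝ) ^ 2) := by
    intro a
    calc ENNReal.ofReal ((∑ j, c j * a j) ^ 2)
        ≤ ENNReal.ofReal (∑ j, J * c j ^ 2 * (a j : ℝ) ^ 2) := by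
          refine ENNReal.ofReal_le_ofReal ?_
          have := sq_sum_le_card_mul_sum_sq (s := Finset.univ) (f := fun j => c j * (a j : ℝ))
          simpa [Finset.mul_sum, mul_pow, mul_assoc] using this
      _ = _ := by
          rw [ENNReal.ofReal_sum_of_nonneg fun j _ => by positivity]
          exact Finset.sum_congr rfl fun j _ => ENNReal.ofReal_mul (by positivity)
  refine ne_top_of_le_ne_top ?_ (expect_mono fun a _ => h1 a)
  rw [expect_finset_sum]
  refine ENNReal.sum_ne_top.2 fun j _ => ?_
  rw [expect_const_mul, expect_arrivals_eval p j fun k => ENNReal.ofReal ((k : ℝ) ^ 2),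
    expect_eq_ofReal_tsum (p j) (fun k => by positivity) (hp j)]
  exact ENNReal.mul_ne_top ENNReal.ofReal_ne_top ENNReal.ofReal_ne_top

/-- Some batch vector of positive probability exceeds any level below the mean. -/
theorem exists_arrivals_lt {p : Fin J → PMF ℕ} (hp : ∀ j, HasSecondMoment (p j)) {c : Fin J → ℝ}
    (hc : ∀ j, 0 ≤ c j) {D : ℝ} (hD : 0 ≤ D) (h : D < ∑ j, meanArrivals (p j) * c j) :
    ∃ a ∈ (arrivals p).support, D < ∑ j, c j * (a j : ℝ) := by
  by_contra! hcon
  have h1 := expect_arrivals_sum hp hc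
  have h2 : expect (arrivals p) (fun a => ENNReal.ofReal (∑ j, c j * a j)) ≤ ENNReal.ofReal D :=
    (expect_mono fun a ha => ENNReal.ofReal_le_ofReal (hcon a ha)).trans (expect_const _ _).le
  rw [h1, ENNReal.ofReal_le_ofReal_iff hD] at h2
  linarith

/-! #### One transition -/

theorem expect_kernel (S : Fin J → ℝ) (φ : Fin J → Schedule J → ℝ) (p : Fin J → PMF ℕ)
    (ω : State J → PMF (Schedule J)) (α : State J) (f : State J → ℝ≥0∞) :
    expect (kernel S φ p ω α) f =
      expect (ω α) fun s => expect (arrivals p) fun a => f (next S φ α s a) := by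
  simp only [kernel, expect_bind, expect_map]

/-- A bound for each schedule and batch integrates to a drift bound. The term `h` stays on the left
because subtraction in `ℝ≥0∞` truncates; both drift estimates move it across only after its
expectation is known. -/
theorem expect_kernel_add_le {S : Fin J → ℝ} {φ : Fin J → Schedule J → ℝ} {p : Fin J → PMF ℕ}
    {ω : State J → PMF (Schedule J)} {α : State J} {f : State J → ℝ≥0∞}
    {h g : (Fin J → ℕ) → ℝ≥0∞}
    (H : ∀ s ∈ (ω α).support, ∀ a ∈ (arrivals p).support, f (next S φ α s a) + h a ≤ g a) :
    expect (kernel S φ p ω α) f + expect (arrivals p) h ≤ expect (arrivals p) g := by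
  rw [expect_kernel, ← expect_const (ω α) (expect (arrivals p) h),
    ← expect_const (ω α) (expect (arrivals p) g), ← expect_add]
  refine expect_mono fun s hs => ?_
  rw [← expect_add]
  exact expect_mono fun a ha => H s hs a ha

theorem kernel_next_ne_zero {S : Fin J → ℝ} {φ : Fin J → Schedule J → ℝ} {p : Fin J → PMF ℕ}
    {ω : State J → PMF (Schedule J)} {α : State J} {s : Schedule J} (hs : s ∈ (ω α).support)
    {a : Fin J → ℕ} (ha : a ∈ (arrivals p).support) :
    kernel S φ p ω α (next S φ α s a) ≠ 0 := by
  rw [kernel, ← PMF.mem_support_iff, PMF.mem_support_bind_iff]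
  exact ⟨s, hs, (PMF.mem_support_map_iff _ _ _).2 ⟨a, ha, rfl⟩⟩

/-- The total weight of the customers in a state. -/
def load (w : Fin J → ℝ → ℝ) (α : State J) : ℝ := ∑ j, ((α j).map (w j)).sum

/-- The weight of a customer of residual requirement `x` after receiving the quantum `q`. -/
def served (w : ℝ → ℝ) (q x : ℝ) : ℝ := if 0 < x - q then w (x - q) else 0

theorem sum_map_filter_served (w : ℝ → ℝ) (q : ℝ) (l : List ℝ) :
    (((l.map fun x => x - q).filter fun x => decide (0 < x)).map w).sum
      = (l.map (served w q)).sum := by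
  induction l with
  | nil => rfl
  | cons x l ih =>
    by_cases hx : 0 < x - q
    · simp only [List.map_cons, List.filter_cons, hx, decide_true, if_true, List.sum_cons, ih]
      simp only [served, hx, if_true]
    · simp only [List.map_cons, List.filter_cons, hx, decide_false, List.sum_cons, ← ih]
      simp [served, hx]

theorem load_next (w : Fin J → ℝ → ℝ) (S : Fin J → ℝ) (φ : Fin J → Schedule J → ℝ) (α : State J)
    (s a : Fin J → ℕ) :
    load w (next S φ α s a) =
      ∑ j, ((((α j).take (s j)).map (served (w j) (φ j s))).sum
        + (((α j).drop (s j)).map (w j)).sum) + ∑ j, w j (S j) * a j := by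
  rw [load, ← Finset.sum_add_distrib]
  refine Finset.sum_congr rfl fun j _ => ?_
  simp only [next, List.map_append, List.sum_append, sum_map_filter_served, List.map_replicate,
    List.sum_replicate, nsmul_eq_mul, mul_comm]

theorem load_eq (w : Fin J → ℝ → ℝ) (α : State J) (s : Fin J → ℕ) :
    load w α = ∑ j, ((((α j).take (s j)).map (w j)).sum
        + (((α j).drop (s j)).map (w j)).sum) := by
  refine Finset.sum_congr rfl fun j _ => ?_
  rw [← List.sum_append, ← List.map_append, List.take_append_drop]

theorem sum_map_add_le {l : List ℝ} {u v : ℝ → ℝ} {d : ℝ} (h : ∀ x ∈ l, u x + d ≤ v x) :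
    (l.map u).sum + l.length * d ≤ (l.map v).sum := by
  induction l with
  | nil => simp
  | cons x l ih =>
    have h1 := h x (by simp)
    have h2 := ih fun y hy => h y (by simp [hy])
    simp only [List.map_cons, List.sum_cons, List.length_cons, Nat.cast_add, Nat.cast_one]
    linarith

/-- Only the first `s j` customers of queue `j` change weight, and `hs` makes them exactly `s j` in
number, so a loss of at least `d j` each is counted `s j` times. -/
theorem load_next_add_le {w : Fin J → ℝ → ℝ} {S : Fin J → ℝ} {φ : Fin J → Schedule J → ℝ}
    {α : State J} {s : Fin J → ℕ} (a : Fin J → ℕ) (hs : ∀ j, s j ≤ (α j).length) {d : Fin J → ℝ}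
    (h : ∀ j, 0 < s j → ∀ x ∈ α j, served (w j) (φ j s) x + d j ≤ w j x) :
    load w (next S φ α s a) + ∑ j, s j * d j ≤ load w α + ∑ j, w j (S j) * a j := by
  have key : ∀ j, (((α j).take (s j)).map (served (w j) (φ j s))).sum + s j * d j
      ≤ (((α j).take (s j)).map (w j)).sum := by
    intro j
    rcases (s j).eq_zero_or_pos with h0 | h0
    · simp [h0]
    · have := sum_map_add_le (l := (α j).take (s j)) fun x hx =>
        h j h0 x (List.mem_of_mem_take hx)
      rwa [List.length_take, min_eq_left (hs j)] at this
  rw [load_next, load_eq w α s]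
  have := Finset.sum_le_sum fun j (_ : j ∈ Finset.univ) => key j
  simp only [Finset.sum_add_distrib] at this ⊢
  linarith

theorem le_load_next_add {w : Fin J → ℝ → ℝ} {S : Fin J → ℝ} {φ : Fin J → Schedule J → ℝ}
    {α : State J} {s : Fin J → ℕ} (a : Fin J → ℕ) (hs : ∀ j, s j ≤ (α j).length) {d : Fin J → ℝ}
    (h : ∀ j, 0 < s j → ∀ x ∈ α j, w j x ≤ served (w j) (φ j s) x + d j) :
    load w α + ∑ j, w j (S j) * a j ≤ load w (next S φ α s a) + ∑ j, s j * d j := by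
  have key : ∀ j, (((α j).take (s j)).map (w j)).sum
      ≤ (((α j).take (s j)).map (served (w j) (φ j s))).sum + s j * d j := by
    intro j
    rcases (s j).eq_zero_or_pos with h0 | h0
    · simp [h0]
    · have := sum_map_add_le (l := (α j).take (s j)) (u := w j) (d := -d j)
        (v := served (w j) (φ j s)) fun x hx => by
          linarith [h j h0 x (List.mem_of_mem_take hx)]
      rw [List.length_take, min_eq_left (hs j)] at this
      linarith
  rw [load_next, load_eq w α s]
  have := Finset.sum_le_sum fun j (_ : j ∈ Finset.univ) => key j
  simp only [Finset.sum_add_distrib] at this ⊢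
  linarith

theorem numCustomers_mul_le_load {w : Fin J → ℝ → ℝ} {α : State J} {η : ℝ}
    (h : ∀ j, ∀ x ∈ α j, η ≤ w j x) : numCustomers α * η ≤ load w α := by
  rw [numCustomers, load]
  push_cast
  rw [Finset.sum_mul]
  refine Finset.sum_le_sum fun j _ => ?_
  simpa using sum_map_add_le (l := α j) (u := fun _ => 0) fun x hx => by simpa using h j x hx

theorem load_le_numCustomers_mul {w : Fin J → ℝ → ℝ} {α : State J} {W : ℝ}
    (h : ∀ j, ∀ x ∈ α j, w j x ≤ W) : load w α ≤ numCustomers α * W := by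
  rw [numCustomers, load]
  push_cast
  rw [Finset.sum_mul]
  refine Finset.sum_le_sum fun j _ => ?_
  have := sum_map_add_le (l := α j) (u := w j) (v := fun _ => 0) (d := -W)
    fun x hx => by linarith [h j x hx]
  simp only [List.map_const', List.sum_replicate, smul_zero] at this
  linarith

theorem load_one (α : State J) : load (fun _ _ => 1) α = numCustomers α := by
  simp [load, numCustomers]

/-! #### Finiteness -/

theorem finite_schedulesLE (J K : ℕ) : (schedulesLE J K).Finite :=
  (Set.finite_Iic fun _ => K).subset fun s (hs : ∑ j, s j ≤ K) j =>
    (Finset.single_le_sum (f := s) (fun _ _ => Nat.zero_le _) (Finset.mem_univ j)).trans hs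

theorem schedulesEq_subset (J K : ℕ) : schedulesEq J K ⊆ schedulesLE J K :=
  fun s (hs : ∑ j, s j = K) => hs.le

theorem finite_schedulesEq (J K : ℕ) : (schedulesEq J K).Finite :=
  (finite_schedulesLE J K).subset (schedulesEq_subset J K)

theorem single_mem_schedulesEq (K : ℕ) (j : Fin J) : Pi.single j K ∈ schedulesEq J K := by
  simp [schedulesEq, Finset.sum_pi_single']

theorem finite_lists {T : Type*} {A : Set T} (hA : A.Finite) (N : ℕ) :
    {l : List T | (∀ x ∈ l, x ∈ A) ∧ l.length ≤ N}.Finite := by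
  have : Finite A := hA
  refine ((List.finite_length_le A N).image (List.map Subtype.val)).subset ?_
  rintro l ⟨hl, hN⟩
  lift l to List A using hl
  exact ⟨l, by simpa using hN, rfl⟩

/-- The quanta of scheduled customers take finitely many positive values, so they are at least some
`δ > 0`, and fewer than `S j / δ` of them can be subtracted while the residual stays positive. -/
theorem finite_residualValues {K : ℕ} (S : Fin J → ℝ) {φ : Fin J → Schedule J → ℝ}
    (hφ : IsServiceQuantum K φ) (j : Fin J) : (residualValues K S φ j).Finite := by
  have hA : {s | s ∈ schedulesLE J K ∧ 0 < s j}.Finite :=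
    (finite_schedulesLE J K).subset fun s hs => hs.1
  obtain ⟨δ, hδ, hle⟩ : ∃ δ > 0, ∀ s ∈ {s | s ∈ schedulesLE J K ∧ 0 < s j}, δ ≤ φ j s := by
    rcases Set.eq_empty_or_nonempty {s | s ∈ schedulesLE J K ∧ 0 < s j} with h | h
    · exact ⟨1, one_pos, by simp [h]⟩
    · obtain ⟨s, hs, hmin⟩ := Set.exists_min_image _ (φ j) hA h
      exact ⟨φ j s, (hφ s hs.1 j).2 hs.2, hmin⟩
  refine ((finite_lists hA ⌊S j / δ⌋₊).image fun l => S j - (l.map (φ j)).sum).subset ?_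
  rintro x ⟨hx, l, hl, rfl⟩
  refine ⟨l, ⟨hl, Nat.le_floor ?_⟩, rfl⟩
  rw [le_div_iff₀ hδ]
  have : ∀ l : List (Schedule J), (∀ s ∈ l, s ∈ schedulesLE J K ∧ 0 < s j) →
      l.length * δ ≤ (l.map (φ j)).sum := by
    intro l
    induction l with
    | nil => simp
    | cons s l ih =>
      intro h
      have h1 := hle s (h s (by simp))
      have h2 := ih fun y hy => h y (by simp [hy])
      simp only [List.map_cons, List.sum_cons, List.length_cons, Nat.cast_add, Nat.cast_one]
      linarith
  linarith [this l hl]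

theorem finite_numCustomers_le {K : ℕ} (S : Fin J → ℝ) {φ : Fin J → Schedule J → ℝ}
    (hφ : IsServiceQuantum K φ) (N : ℕ) :
    {α ∈ stateVectors K S φ | numCustomers α ≤ N}.Finite := by
  refine (Set.Finite.pi' fun j => finite_lists (finite_residualValues S hφ j) N).subset ?_
  rintro α ⟨hα, hN⟩ j
  exact ⟨hα j, (Finset.single_le_sum (f := fun j => (α j).length) (fun _ _ => Nat.zero_le _)
    (Finset.mem_univ j)).trans hN⟩

theorem pos_of_mem_stateVectors {K : ℕ} {S : Fin J → ℝ} {φ : Fin J → Schedule J → ℝ} {α : State J}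
    (hα : α ∈ stateVectors K S φ) {j : Fin J} {x : ℝ} (hx : x ∈ α j) : 0 < x := (hα j x hx).1

theorem le_of_mem_stateVectors {K : ℕ} {S : Fin J → ℝ} {φ : Fin J → Schedule J → ℝ}
    (hφ : IsServiceQuantum K φ) {α : State J} (hα : α ∈ stateVectors K S φ) {j : Fin J} {x : ℝ}
    (hx : x ∈ α j) : x ≤ S j := by
  obtain ⟨-, l, hl, rfl⟩ := hα j x hx
  have : 0 ≤ (l.map (φ j)).sum := List.sum_nonneg fun y hy => by
    obtain ⟨s, hs, rfl⟩ := List.mem_map.1 hy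
    exact ((hφ s (hl s hs).1 j).2 (hl s hs).2).le
  linarith

/-! ### Drift of the load: stability and transience -/

section Drift

variable {K : ℕ} {S : Fin J → ℝ} {p : Fin J → PMF ℕ} {φ : Fin J → Schedule J → ℝ}
  {ω : State J → PMF (Schedule J)} {C : Set (State J)} {w : Fin J → ℝ → ℝ}

theorem load_nonneg (hw : ∀ j x, 0 < x → 0 ≤ w j x) {α : State J} (hα : α ∈ stateVectors K S φ) :
    0 ≤ load w α := by
  simpa using numCustomers_mul_le_load (w := w) (η := 0) fun j x hx =>
    hw j x (pos_of_mem_stateVectors hα hx)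

/-- Used contrapositively: a load above this bound forces at least `K` customers, hence a full
schedule. -/
theorem load_le_of_numCustomers_lt (hS : ∀ j, 0 < S j) (hφ : IsServiceQuantum K φ)
    (hw : ∀ j x, 0 < x → 0 ≤ w j x) (hmono : ∀ j, Monotone (w j)) {α : State J}
    (hα : α ∈ stateVectors K S φ) (hn : numCustomers α < K) :
    load w α ≤ K * ∑ j, w j (S j) := by
  have h0 : ∀ j ∈ Finset.univ, 0 ≤ w j (S j) := fun j _ => hw j _ (hS j)
  calc load w α ≤ numCustomers α * ∑ j, w j (S j) :=
        load_le_numCustomers_mul fun j x hx =>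
          (hmono j (le_of_mem_stateVectors hφ hα hx)).trans
            (Finset.single_le_sum (f := fun j => w j (S j)) h0 (Finset.mem_univ j))
    _ ≤ _ := by
      gcongr
      exact Finset.sum_nonneg h0

/-- The drift of the squared load. -/
theorem expect_load_sq_le (hp : ∀ j, HasSecondMoment (p j)) (hw : ∀ j, 0 ≤ w j (S j))
    {α : State J} (hα : 0 ≤ load w α) {d : ℝ} (hd : 0 ≤ d)
    (H : ∀ s ∈ (ω α).support, ∀ a ∈ (arrivals p).support, 0 ≤ load w (next S φ α s a) ∧
      load w (next S φ α s a) + d ≤ load w α + ∑ j, w j (S j) * a j) :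
    expect (kernel S φ p ω α) (fun β => ENNReal.ofReal (load w β ^ 2)) ≤
      ENNReal.ofReal (load w α ^ 2 - 2 * (d - ∑ j, meanArrivals (p j) * w j (S j)) * load w α
        + d ^ 2 + (expect (arrivals p)
          fun a => ENNReal.ofReal ((∑ j, w j (S j) * a j) ^ 2)).toReal) := by
  set L := load w α with hL
  set m := ∑ j, meanArrivals (p j) * w j (S j) with hm
  have hm0 : 0 ≤ m := Finset.sum_nonneg fun j _ => mul_nonneg (meanArrivals_nonneg _) (hw j)
  have h1 := expect_kernel_add_le (S := S) (φ := φ) (p := p) (ω := ω) (α := α)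
    (f := fun β => ENNReal.ofReal (load w β ^ 2)) (h := fun _ => ENNReal.ofReal (2 * d * L))
    (g := fun a => ENNReal.ofReal (L ^ 2 + d ^ 2)
      + ENNReal.ofReal (2 * L) * ENNReal.ofReal (∑ j, w j (S j) * a j)
      + ENNReal.ofReal ((∑ j, w j (S j) * a j) ^ 2)) ?_
  · rw [expect_const, expect_add, expect_add, expect_const, expect_const_mul,
      expect_arrivals_sum hp hw, ← hm, ← ENNReal.ofReal_toReal (expect_arrivals_sum_sq hp _),
      ← ENNReal.ofReal_mul (by positivity), ← ENNReal.ofReal_add (by positivity) (by positivity),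
      ← ENNReal.ofReal_add (by positivity) ENNReal.toReal_nonneg] at h1
    refine (ENNReal.le_sub_of_add_le_right ENNReal.ofReal_ne_top h1).trans ?_
    rw [← ENNReal.ofReal_sub _ (by positivity)]
    exact ENNReal.ofReal_le_ofReal (by ring_nf; rfl)
  · intro s hs a ha
    obtain ⟨h2, h3⟩ := H s hs a ha
    have hZ : 0 ≤ ∑ j, w j (S j) * a j :=
      Finset.sum_nonneg fun j _ => mul_nonneg (hw j) (Nat.cast_nonneg _)
    set Z := ∑ j, w j (S j) * a j
    set L' := load w (next S φ α s a)
    rw [← ENNReal.ofReal_mul (by positivity), ← ENNReal.ofReal_add (by positivity) (by positivity),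
      ← ENNReal.ofReal_add (by positivity) (by positivity),
      ← ENNReal.ofReal_add (by positivity) (by positivity)]
    refine ENNReal.ofReal_le_ofReal ?_
    -- Squaring is legitimate because `0 ≤ L'`; of the expansion only the cross term `-2dZ ≤ 0` is
    -- discarded.
    have h4 : L' ^ 2 ≤ (L + Z - d) ^ 2 := pow_le_pow_left₀ h2 (by linarith) 2
    nlinarith [mul_nonneg hZ hd]

/-- A nonidling queue is stable and regular if, when `K` customers are served, the load decreases
by service at a rate exceeding the rate at which arrivals bring in load. -/
theorem isRegular_and_isStable (hS : ∀ j, 0 < S j) (hp : ∀ j, HasSecondMoment (p j))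
    (hφ : IsServiceQuantum K φ) (hω : IsNonIdling K ω) (hCS : C ⊆ stateVectors K S φ)
    (hC : IsIrreducibleOn (kernel S φ p ω) C) {η d : ℝ} (hη : 0 < η)
    (hwη : ∀ j x, 0 < x → η ≤ w j x) (hmono : ∀ j, Monotone (w j))
    (hd : ∑ j, meanArrivals (p j) * w j (S j) < d)
    (hdrop : ∀ s ∈ schedulesEq J K, ∃ e : Fin J → ℝ, d ≤ ∑ j, s j * e j ∧
      ∀ j, 0 < s j → ∀ x, 0 < x → served (w j) (φ j s) x + e j ≤ w j x) :
    IsRegular (kernel S φ p ω) C (fun α => ENNReal.ofReal (1 + load w α)) ∧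
      IsStable (kernel S φ p ω) C := by
  have hw : ∀ j x, 0 < x → 0 ≤ w j x := fun j x hx => hη.le.trans (hwη j x hx)
  have hwS : ∀ j, 0 ≤ w j (S j) := fun j => hw j _ (hS j)
  set m := ∑ j, meanArrivals (p j) * w j (S j) with hm
  have hm0 : 0 ≤ m := Finset.sum_nonneg fun j _ => mul_nonneg (meanArrivals_nonneg _) (hwS j)
  set e2 := (expect (arrivals p)
    fun a => ENNReal.ofReal ((∑ j, w j (S j) * a j) ^ 2)).toReal with he2
  have he0 : 0 ≤ e2 := ENNReal.toReal_nonneg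
  obtain ⟨ε, hε, rfl⟩ : ∃ ε > 0, d = m + ε := ⟨d - m, by linarith, by ring⟩
  have hload : ∀ α ∈ C, 0 ≤ load w α := fun α hα => load_nonneg hw (hCS hα)
  have hnext : ∀ α ∈ C, ∀ s ∈ (ω α).support, ∀ a ∈ (arrivals p).support,
      0 ≤ load w (next S φ α s a) := fun α hα s hs a ha =>
    hload _ (hC.closed α hα _ (kernel_next_ne_zero hs ha))
  -- Valid in every state with rate `0`: service never raises the load, the weights being monotone
  -- and nonnegative.
  have drift0 : ∀ α ∈ C, expect (kernel S φ p ω α) (fun β => ENNReal.ofReal (load w β ^ 2)) ≤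
      ENNReal.ofReal (load w α ^ 2 + 2 * m * load w α + e2) := by
    intro α hα
    refine (expect_load_sq_le hp hwS (hload α hα) le_rfl
      fun s hs a ha => ⟨hnext α hα s hs a ha, ?_⟩).trans
        (ENNReal.ofReal_le_ofReal (by rw [← hm, ← he2]; ring_nf; rfl))
    obtain ⟨hsK, hsl⟩ := hω.feasible α s hs
    have := load_next_add_le (w := w) (S := S) (φ := φ) (d := fun _ => 0) a hsl
      fun j hj x hx => by
        have hx0 := pos_of_mem_stateVectors (hCS hα) hx
        rw [add_zero, served]
        split_ifs
        · exact hmono j (by linarith [(hφ s hsK j).2 hj])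
        · exact hw j x hx0
    simpa using this
  have drift1 : ∀ α ∈ C, K ≤ numCustomers α →
      expect (kernel S φ p ω α) (fun β => ENNReal.ofReal (load w β ^ 2)) ≤
      ENNReal.ofReal (load w α ^ 2 - 2 * ε * load w α + (m + ε) ^ 2 + e2) := by
    intro α hα hn
    refine (expect_load_sq_le hp hwS (hload α hα) (add_nonneg hm0 hε.le)
      fun s hs a ha => ⟨hnext α hα s hs a ha, ?_⟩).trans
        (ENNReal.ofReal_le_ofReal (by rw [← hm, ← he2]; ring_nf; rfl))
    obtain ⟨e, he, hse⟩ := hdrop s (hω.nonIdling α hn s hs)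
    have := load_next_add_le (w := w) (S := S) (φ := φ) (d := e) a (hω.feasible α s hs).2
      fun j hj x hx => hse j hj x (pos_of_mem_stateVectors (hCS hα) hx)
    linarith
  -- Beyond the first term at least `K` customers are present; beyond the second the drift `-2 *
  -- load + const` of `V` is at most `-(1 + load)`.
  set R := max (K * ∑ j, w j (S j)) (1 + ((m + ε) ^ 2 + e2) / ε) with hR
  have hR0 : 0 ≤ R := le_max_of_le_right (by positivity)
  set V : State J → ℝ≥0∞ := fun α => ENNReal.ofReal ε⁻¹ * ENNReal.ofReal (load w α ^ 2) with hV
  set c : State J → ℝ≥0∞ := fun α => ENNReal.ofReal (1 + load w α) with hc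
  have foster : ∀ y ∈ C, ∃ B : ℝ≥0∞, B ≠ ⊤ ∧
      ∀ α ∈ C, expectedCost (kernel S φ p ω) {y} c α ≤ V α + B := by
    refine fun y hy => exists_expectedCost_le hC (F := {α | load w α ≤ R}) ?_
      (b := ENNReal.ofReal (ε⁻¹ * (2 * m * R + e2) + 1 + R)) ENNReal.ofReal_ne_top ?_ ?_ hy
    · refine (finite_numCustomers_le S hφ ⌊R / η⌋₊).subset ?_
      rintro α ⟨hα, hαR⟩
      refine ⟨hCS hα, Nat.le_floor ?_⟩
      rw [le_div_iff₀ hη]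
      exact (numCustomers_mul_le_load fun j x hx =>
        hwη j x (pos_of_mem_stateVectors (hCS hα) hx)).trans hαR
    · intro α hα hαF
      have hαR : R < load w α := not_le.1 hαF
      have hn : K ≤ numCustomers α := by
        by_contra! hn
        exact absurd ((load_le_of_numCustomers_lt hS hφ hw hmono (hCS hα) hn).trans
          (le_max_left _ _)) hαF
      have h0 := hload α hα
      have h1 : 1 + ((m + ε) ^ 2 + e2) / ε ≤ load w α := (le_max_right _ _).trans hαR.le
      simp only [hV, hc]
      rw [expect_const_mul]
      have h2 : ε⁻¹ * (load w α ^ 2 - 2 * ε * load w α + (m + ε) ^ 2 + e2)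
          = ε⁻¹ * load w α ^ 2 - 2 * load w α + ((m + ε) ^ 2 + e2) / ε := by
        field_simp
        ring
      calc _ ≤ ENNReal.ofReal ε⁻¹ * ENNReal.ofReal (load w α ^ 2 - 2 * ε * load w α
              + (m + ε) ^ 2 + e2) + ENNReal.ofReal (1 + load w α) := by
            gcongr
            exact drift1 α hα hn
        _ ≤ ENNReal.ofReal (ε⁻¹ * load w α ^ 2 - (1 + load w α))
              + ENNReal.ofReal (1 + load w α) := by
            rw [← ENNReal.ofReal_mul (by positivity), h2]
            gcongr
            linarith
        _ = ENNReal.ofReal ε⁻¹ * ENNReal.ofReal (load w α ^ 2) := by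
            rw [← ENNReal.ofReal_mul (by positivity), ← ENNReal.ofReal_add _ (by positivity)]
            · congr 1; ring
            · have h3 : ε ≤ ((m + ε) ^ 2 + e2) / ε := by
                rw [le_div_iff₀ hε]
                nlinarith
              rw [sub_nonneg, inv_mul_eq_div, le_div_iff₀ hε]
              nlinarith
    · intro α hα (hαF : load w α ≤ R)
      have h0 := hload α hα
      simp only [hV, hc]
      rw [expect_const_mul]
      calc _ ≤ ENNReal.ofReal ε⁻¹ * ENNReal.ofReal (load w α ^ 2 + 2 * m * load w α + e2)
              + ENNReal.ofReal (1 + load w α) := by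
            gcongr
            exact drift0 α hα
        _ ≤ _ := by
            rw [← ENNReal.ofReal_mul (by positivity), ← ENNReal.ofReal_mul (by positivity),
              ← ENNReal.ofReal_add (by positivity) (by positivity),
              ← ENNReal.ofReal_add (by positivity) (by positivity)]
            refine ENNReal.ofReal_le_ofReal ?_
            have : ε⁻¹ * (2 * m * load w α + e2) ≤ ε⁻¹ * (2 * m * R + e2) := by gcongr
            linarith
  have hVtop : ∀ α ∈ C, V α ≠ ⊤ := fun α _ =>
    ENNReal.mul_ne_top ENNReal.ofReal_ne_top ENNReal.ofReal_ne_top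
  have hrec : ∀ y ∈ C, expectedCost (kernel S φ p ω) {y} c y < ⊤ := by
    intro y hy
    obtain ⟨B, hB, h⟩ := foster y hy
    exact (h y hy).trans_lt (ENNReal.add_lt_top.2 ⟨(hVtop y hy).lt_top, hB.lt_top⟩)
  have hone : ∀ y ∈ C, expectedCost (kernel S φ p ω) {y} (fun _ => 1) y < ⊤ := by
    intro y hy
    refine (expectedCost_mono hC.closed {y} (fun α hα => ?_) hy).trans_lt (hrec y hy)
    exact ENNReal.one_le_ofReal.2 (by linarith [hload α hα])
  refine ⟨isRegular_of_expectedCost_le hVtop foster, hone, ?_⟩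
  obtain ⟨y, hy⟩ := hC.nonempty
  obtain ⟨π, hπ, hπf⟩ := exists_stationary hC.closed hy (hone y hy)
  refine ⟨π, hπ, ?_⟩
  have hle : ∑' α, π α * (numCustomers α : ℝ≥0∞) ≤
      ∑' α, π α * (ENNReal.ofReal η⁻¹ * c α) := by
    refine expect_mono fun α hα => ?_
    have hαC : α ∈ C := hπ.1 hα
    have h0 := hload α hαC
    have h1 := numCustomers_mul_le_load (w := w) (α := α) fun j x hx =>
      hwη j x (pos_of_mem_stateVectors (hCS hαC) hx)
    simp only [hc]
    rw [← ENNReal.ofReal_mul (by positivity), ← ENNReal.ofReal_natCast]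
    refine ENNReal.ofReal_le_ofReal ?_
    rw [inv_mul_eq_div, le_div_iff₀ hη]
    linarith
  refine hle.trans_lt ?_
  rw [hπf, expectedCost_const_mul]
  refine ENNReal.mul_lt_top (ENNReal.inv_lt_top.2 ?_)
    (ENNReal.mul_lt_top ENNReal.ofReal_lt_top (hrec y hy))
  rw [expectedCost_eq_add]
  exact lt_of_lt_of_le one_pos le_self_add

/-- A queue is transient if, when `K` customers are served, the load decreases by service at a
rate smaller than the rate at which arrivals bring in load, and large loads are accessible. -/
theorem isUnstable_of_load (hS : ∀ j, 0 < S j) (hp : ∀ j, HasSecondMoment (p j))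
    (hφ : IsServiceQuantum K φ) (hω : IsNonIdling K ω) (hCS : C ⊆ stateVectors K S φ)
    (hC : IsClosedSet (kernel S φ p ω) C) {D : ℝ}
    (hw : ∀ j x, 0 < x → 0 ≤ w j x) (hmono : ∀ j, Monotone (w j)) (hD0 : 0 ≤ D)
    (hD : D < ∑ j, meanArrivals (p j) * w j (S j))
    (hdrop : ∀ s ∈ schedulesEq J K, ∃ e : Fin J → ℝ, ∑ j, s j * e j ≤ D ∧
      ∀ j, 0 < s j → ∀ x, 0 < x → w j x ≤ served (w j) (φ j s) x + e j)
    (hreach : ∀ α ∈ C, ∀ R : ℝ, ∃ β, Accessible (kernel S φ p ω) α β ∧ R ≤ load w β) :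
    IsUnstable (kernel S φ p ω) C := by
  intro α hα
  have hwS : ∀ j, 0 ≤ w j (S j) := fun j => hw j _ (hS j)
  set m := ∑ j, meanArrivals (p j) * w j (S j) with hm
  set e2 := (expect (arrivals p)
    fun a => ENNReal.ofReal ((∑ j, w j (S j) * a j) ^ 2)).toReal with he2
  have he0 : 0 ≤ e2 := ENNReal.toReal_nonneg
  obtain ⟨ε, hε, hmε⟩ : ∃ ε > 0, m = D + ε := ⟨m - D, by linarith, by ring⟩
  -- The terms ensure in turn `1 ≤ H α`, full service wherever `H < 1`, and `e2 ≤ ε * u` below, so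
  -- that the second-order error is beaten by the excess `ε`.
  set R := max (load w α) (max (K * ∑ j, w j (S j)) (D + e2 / ε)) with hR
  have hαR : load w α ≤ R := le_max_left _ _
  have hload : ∀ α ∈ C, 0 ≤ load w α := fun α hα => load_nonneg hw (hCS hα)
  have hR0 : 0 ≤ R := (hload α hα).trans hαR
  obtain ⟨β, hβ, hβR⟩ := hreach α hα (R + 1)
  refine isTransientState_of_superharmonic hC hα hβ
    (H := fun γ => ENNReal.ofReal ((1 + R) / (1 + load w γ))) ?_ ?_ ?_
  · intro γ hγ hlt
    have hL0 := hload γ hγ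
    have hL : R < load w γ := by
      rw [ENNReal.ofReal_lt_one, div_lt_one (by positivity)] at hlt
      linarith
    have hn : K ≤ numCustomers γ := by
      by_contra! hn
      exact absurd (((load_le_of_numCustomers_lt hS hφ hw hmono (hCS hγ) hn).trans
        (le_max_left _ _)).trans (le_max_right _ _)) (not_le.2 hL)
    have hLD : D + e2 / ε < load w γ :=
      (((le_max_right _ _).trans (le_max_right _ _)).trans_lt hL)
    set L := load w γ
    -- `u` bounds `1 + load` from below after service and before arrivals.
    obtain ⟨u, hu⟩ : ∃ u, u = 1 + L - D := ⟨_, rfl⟩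
    have hu' : e2 / ε < u := by linarith
    have hu0 : 0 < u := lt_of_le_of_lt (by positivity) hu'
    have h1 := expect_kernel_add_le (S := S) (φ := φ) (p := p) (ω := ω) (α := γ)
      (f := fun β => ENNReal.ofReal ((1 + R) / (1 + load w β)))
      (h := fun a => ENNReal.ofReal ((1 + R) / u ^ 2) *
        ENNReal.ofReal (∑ j, w j (S j) * a j))
      (g := fun a => ENNReal.ofReal ((1 + R) / u)
        + ENNReal.ofReal ((1 + R) / u ^ 3) * ENNReal.ofReal ((∑ j, w j (S j) * a j) ^ 2)) ?_
    · have hm0 : 0 ≤ m := by linarith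
      rw [expect_const_mul, expect_add, expect_const, expect_const_mul,
        expect_arrivals_sum hp hwS, ← hm,
        ← ENNReal.ofReal_toReal (expect_arrivals_sum_sq hp _), ← he2,
        ← ENNReal.ofReal_mul (by positivity), ← ENNReal.ofReal_mul (by positivity),
        ← ENNReal.ofReal_add (by positivity) (by positivity)] at h1
      refine (ENNReal.le_sub_of_add_le_right ENNReal.ofReal_ne_top h1).trans ?_
      rw [← ENNReal.ofReal_sub _ (by positivity)]
      refine ENNReal.ofReal_le_ofReal ?_
      have h2 : 1 + L = u + D := by rw [hu]; ring
      rw [h2, hmε]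
      have h3 : e2 ≤ ε * u := by
        rw [div_lt_iff₀ hε] at hu'
        linarith
      calc (1 + R) / u + (1 + R) / u ^ 3 * e2 - (1 + R) / u ^ 2 * (D + ε)
          ≤ (1 + R) / u + (1 + R) / u ^ 3 * (ε * u) - (1 + R) / u ^ 2 * (D + ε) := by gcongr
        _ = (1 + R) * ((u - D) / u ^ 2) := by field_simp; ring
        -- This is `(u - D) * (u + D) ≤ u ^ 2`, and `u + D = 1 + L`.
        _ ≤ (1 + R) * (1 / (u + D)) := by
            refine mul_le_mul_of_nonneg_left ?_ (by linarith)
            rw [div_le_div_iff₀ (pow_pos hu0 2) (by linarith)]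
            nlinarith
        _ = _ := by ring
    · intro s hs a ha
      obtain ⟨e, he, hse⟩ := hdrop s (hω.nonIdling γ hn s hs)
      have h2 := le_load_next_add (w := w) (S := S) (φ := φ) (d := e) a (hω.feasible γ s hs).2
        fun j hj x hx => hse j hj x (pos_of_mem_stateVectors (hCS hγ) hx)
      have hZ : 0 ≤ ∑ j, w j (S j) * a j :=
        Finset.sum_nonneg fun j _ => mul_nonneg (hwS j) (Nat.cast_nonneg _)
      set Z := ∑ j, w j (S j) * a j
      have h3 : u + Z ≤ 1 + load w (next S φ γ s a) := by linarith
      rw [← ENNReal.ofReal_mul (by positivity), ← ENNReal.ofReal_mul (by positivity),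
        ← ENNReal.ofReal_add (div_nonneg (by positivity) (by linarith)) (by positivity),
        ← ENNReal.ofReal_add (by positivity) (by positivity)]
      refine ENNReal.ofReal_le_ofReal ?_
      calc (1 + R) / (1 + load w (next S φ γ s a)) + (1 + R) / u ^ 2 * Z
          ≤ (1 + R) / (u + Z) + (1 + R) / u ^ 2 * Z := by gcongr
        -- The exact expansion `1/(u + Z) = 1/u - Z/u² + Z²/(u²(u + Z))`; replacing `u + Z` by `u`
        -- in the remainder leaves only second moments.
        _ = (1 + R) / u + (1 + R) / (u ^ 2 * (u + Z)) * Z ^ 2 := by field_simp; ring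
        _ ≤ (1 + R) / u + (1 + R) / u ^ 3 * Z ^ 2 := by
            gcongr
            nlinarith [sq_nonneg u]
  · rw [ENNReal.one_le_ofReal, one_le_div (by linarith [hload α hα])]
    linarith
  · rw [ENNReal.ofReal_lt_one, div_lt_one (by linarith)]
    linarith

end Drift

/-! ### Accessibility of large loads and the choices of weight -/

section Instances

variable {K : ℕ} {S : Fin J → ℝ} {p : Fin J → PMF ℕ} {φ : Fin J → Schedule J → ℝ}
  {ω : State J → PMF (Schedule J)} {C : Set (State J)} {w : Fin J → ℝ → ℝ}

theorem numCustomers_le_next_add (hω : IsNonIdling K ω) (α : State J) {s : Schedule J}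
    (hs : s ∈ (ω α).support) (a : Fin J → ℕ) :
    numCustomers α ≤ numCustomers (next S φ α s a) + K := by
  obtain ⟨hsK, hsl⟩ := hω.feasible α s hs
  have h := le_load_next_add (w := fun _ _ => 1) (S := S) (φ := φ) (d := fun _ => 1) a hsl
    fun j _ x _ => by unfold served; split_ifs <;> norm_num
  have h1 : (∑ j, (s j : ℝ)) ≤ K := by exact_mod_cast hsK
  have h2 : 0 ≤ ∑ j, (a j : ℝ) := by positivity
  simp only [load_one, one_mul, mul_one] at h
  have h3 : (numCustomers α : ℝ) ≤ numCustomers (next S φ α s a) + K := by linarith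
  exact_mod_cast h3

/-- One step with a large batch of arrivals increases the load. -/
theorem exists_step_load (hω : IsNonIdling K ω) (hCS : C ⊆ stateVectors K S φ) {D : ℝ}
    (hdrop : ∀ s ∈ schedulesEq J K, ∃ e : Fin J → ℝ, ∑ j, s j * e j ≤ D ∧
      ∀ j, 0 < s j → ∀ x, 0 < x → w j x ≤ served (w j) (φ j s) x + e j)
    {a : Fin J → ℕ} (ha : a ∈ (arrivals p).support) {α : State J} (hα : α ∈ C)
    (hn : K ≤ numCustomers α) :
    ∃ β, kernel S φ p ω α β ≠ 0 ∧ load w α + (∑ j, w j (S j) * a j - D) ≤ load w β ∧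
      numCustomers α ≤ numCustomers β + K := by
  obtain ⟨s, hs⟩ := (ω α).support_nonempty
  refine ⟨next S φ α s a, kernel_next_ne_zero hs ha, ?_, numCustomers_le_next_add hω α hs a⟩
  obtain ⟨e, he, hse⟩ := hdrop s (hω.nonIdling α hn s hs)
  have := le_load_next_add (w := w) (S := S) (φ := φ) (d := e) a (hω.feasible α s hs).2
    fun j hj x hx => hse j hj x (pos_of_mem_stateVectors (hCS hα) hx)
  linarith

/-- If many customers are accessible, so are large loads. -/
theorem exists_accessible_load_ge (hS : ∀ j, 0 < S j) (hp : ∀ j, HasSecondMoment (p j))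
    (hω : IsNonIdling K ω) (hCS : C ⊆ stateVectors K S φ)
    (hC : IsClosedSet (kernel S φ p ω) C) {D : ℝ} (hw : ∀ j x, 0 < x → 0 ≤ w j x) (hD0 : 0 ≤ D)
    (hD : D < ∑ j, meanArrivals (p j) * w j (S j))
    (hdrop : ∀ s ∈ schedulesEq J K, ∃ e : Fin J → ℝ, ∑ j, s j * e j ≤ D ∧
      ∀ j, 0 < s j → ∀ x, 0 < x → w j x ≤ served (w j) (φ j s) x + e j)
    (hU : ReachesArbitrarilyMany (kernel S φ p ω) C) {α : State J} (hα : α ∈ C) (R : ℝ) :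
    ∃ β, Accessible (kernel S φ p ω) α β ∧ R ≤ load w β := by
  obtain ⟨a, ha, hDa⟩ := exists_arrivals_lt hp (fun j => hw j _ (hS j)) hD0 hD
  set δ := ∑ j, w j (S j) * (a j : ℝ) - D with hδ
  have hδ0 : 0 < δ := sub_pos.2 hDa
  -- A slot removes at most `K` customers, so `L * K` of them guarantee `L` consecutive full
  -- schedules; with the batch `a` each time, every slot gains at least `δ`.
  have key : ∀ L : ℕ, ∀ γ ∈ C, L * K ≤ numCustomers γ →
      ∃ β, Accessible (kernel S φ p ω) γ β ∧ load w γ + L * δ ≤ load w β := by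
    intro L
    induction L with
    | zero => exact fun γ _ _ => ⟨γ, Relation.ReflTransGen.refl, by simp⟩
    | succ L ih =>
      intro γ hγ hn
      rw [add_mul, one_mul] at hn
      obtain ⟨γ', h1, h2, h3⟩ := exists_step_load hω hCS hdrop ha hγ (by omega)
      obtain ⟨β, h4, h5⟩ := ih γ' (hC γ hγ γ' h1) (by omega)
      refine ⟨β, h4.head h1, ?_⟩
      push_cast
      linarith
  obtain ⟨L, hL⟩ := exists_nat_ge (R / δ)
  obtain ⟨γ, hγ, hn⟩ := hU α hα (L * K)
  have hγC : γ ∈ C := by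
    clear hn
    induction hγ with
    | refl => exact hα
    | tail _ hs ih => exact hC _ ih _ hs
  obtain ⟨β, hβ, hle⟩ := key L γ hγC hn
  rw [div_le_iff₀ hδ0] at hL
  exact ⟨β, hγ.trans hβ, by linarith [load_nonneg hw (hCS hγC)]⟩

/-- When a single customer is served per slot, large loads are always accessible. -/
theorem exists_accessible_load_ge_of_one (hS : ∀ j, 0 < S j) (hp : ∀ j, HasSecondMoment (p j))
    (hω : IsNonIdling 1 ω) (hCS : C ⊆ stateVectors 1 S φ)
    (hC : IsClosedSet (kernel S φ p ω) C) {D : ℝ} (hw : ∀ j x, 0 < x → 0 ≤ w j x) (hD0 : 0 ≤ D)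
    (hD : D < ∑ j, meanArrivals (p j) * w j (S j))
    (hdrop : ∀ s ∈ schedulesEq J 1, ∃ e : Fin J → ℝ, ∑ j, s j * e j ≤ D ∧
      ∀ j, 0 < s j → ∀ x, 0 < x → w j x ≤ served (w j) (φ j s) x + e j)
    {α : State J} (hα : α ∈ C) (R : ℝ) :
    ∃ β, Accessible (kernel S φ p ω) α β ∧ R ≤ load w β := by
  obtain ⟨a, ha, hDa⟩ := exists_arrivals_lt hp (fun j => hw j _ (hS j)) hD0 hD
  set δ := ∑ j, w j (S j) * (a j : ℝ) - D with hδ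
  have hδ0 : 0 < δ := sub_pos.2 hDa
  have step : ∀ γ ∈ C, ∃ β, kernel S φ p ω γ β ≠ 0 ∧ load w γ + δ ≤ load w β := by
    intro γ hγ
    -- For `K = 1` a state is either empty, with nothing to lose, or fully served. Hence the batch
    -- `a` gains `δ` from every state and no reachability assumption is needed.
    rcases Nat.eq_zero_or_pos (numCustomers γ) with h0 | h0
    · obtain ⟨s, hs⟩ := (ω γ).support_nonempty
      refine ⟨next S φ γ s a, kernel_next_ne_zero hs ha, ?_⟩
      have := le_load_next_add (w := w) (S := S) (φ := φ) (d := fun _ => 0) a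
        (hω.feasible γ s hs).2 fun j hj x hx => by
          have : (γ j).length = 0 := Finset.sum_eq_zero_iff.1 h0 j (Finset.mem_univ j)
          simp [List.length_eq_zero_iff.1 this] at hx
      simp only [mul_zero, Finset.sum_const_zero] at this
      linarith
    · obtain ⟨β, h1, h2, -⟩ := exists_step_load hω hCS hdrop ha hγ h0
      exact ⟨β, h1, h2⟩
  have key : ∀ L : ℕ, ∃ β ∈ C, Accessible (kernel S φ p ω) α β ∧ L * δ ≤ load w β := by
    intro L
    induction L with
    | zero => exact ⟨α, hα, Relation.ReflTransGen.refl, by simpa using load_nonneg hw (hCS hα)⟩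
    | succ L ih =>
      obtain ⟨γ, hγ, h1, h2⟩ := ih
      obtain ⟨β, h3, h4⟩ := step γ hγ
      refine ⟨β, hC γ hγ β h3, h1.tail h3, ?_⟩
      push_cast
      linarith
  obtain ⟨L, hL⟩ := exists_nat_ge (R / δ)
  obtain ⟨β, -, hβ, hle⟩ := key L
  rw [div_le_iff₀ hδ0] at hL
  exact ⟨β, hβ, hL.trans hle⟩

/-! #### Slot counts -/

theorem exists_minQuantum_eq (hK : 1 ≤ K) (φ : Fin J → Schedule J → ℝ) (j : Fin J) :
    ∃ s ∈ schedulesEq J K, 0 < s j ∧ φ j s = minQuantum K φ j := by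
  have hfin : {s | s ∈ schedulesEq J K ∧ 0 < s j}.Finite :=
    (finite_schedulesEq J K).subset fun s hs => hs.1
  have hne : {s | s ∈ schedulesEq J K ∧ 0 < s j}.Nonempty :=
    ⟨Pi.single j K, single_mem_schedulesEq K j, by simp; omega⟩
  obtain ⟨s, hs, h⟩ := (hne.image (φ j)).csInf_mem (hfin.image (φ j))
  exact ⟨s, hs.1, hs.2, h⟩

theorem minQuantum_pos (hK : 1 ≤ K) (hφ : IsServiceQuantum K φ) (j : Fin J) :
    0 < minQuantum K φ j := by
  obtain ⟨s, hs, hsj, h⟩ := exists_minQuantum_eq hK φ j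
  exact h ▸ (hφ s (schedulesEq_subset J K hs) j).2 hsj

theorem minQuantum_le (φ : Fin J → Schedule J → ℝ) {s : Schedule J} (hs : s ∈ schedulesEq J K)
    {j : Fin J} (hsj : 0 < s j) : minQuantum K φ j ≤ φ j s :=
  csInf_le (((finite_schedulesEq J K).subset fun _ hs => hs.1).image (φ j)).bddBelow
    ⟨s, ⟨hs, hsj⟩, rfl⟩

/-- A quantum of at least `q` lowers `x / q` by at least one, and a departing customer still counted
at least one slot. -/
theorem served_ceil_add_one_le {q r x : ℝ} (hq : 0 < q) (hr : q ≤ r) (hx : 0 < x) :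
    served (fun y => (⌈y / q⌉₊ : ℝ)) r x + 1 ≤ ⌈x / q⌉₊ := by
  have h1 : 1 ≤ ⌈x / q⌉₊ := Nat.ceil_pos.2 (div_pos hx hq)
  unfold served
  split_ifs with h
  · have h2 : ⌈(x - r) / q⌉₊ ≤ ⌈x / q⌉₊ - 1 := by
      rw [← Nat.ceil_sub_one]
      refine Nat.ceil_mono ?_
      rw [div_le_iff₀ hq, sub_mul, div_mul_cancel₀ _ hq.ne']
      linarith
    have h3 : ⌈(x - r) / q⌉₊ + 1 ≤ ⌈x / q⌉₊ := by omega
    beta_reduce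
    exact_mod_cast h3
  · simpa using h1

/-- With the quantum exactly `q` no more than one slot is lost: a customer leaves only when `x ≤ q`,
where the count is at most one. -/
theorem ceil_le_served_add_one {q x : ℝ} (hq : 0 < q) :
    (⌈x / q⌉₊ : ℝ) ≤ served (fun y => (⌈y / q⌉₊ : ℝ)) q x + 1 := by
  unfold served
  split_ifs with h
  · have h1 : x / q = (x - q) / q + 1 := by field_simp; ring
    rw [h1, Nat.ceil_add_one (div_pos h hq).le]
    simp
  · have : ⌈x / q⌉₊ ≤ 1 := by
      refine Nat.ceil_le.2 ?_
      rw [div_le_iff₀ hq]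
      push_cast
      linarith
    rw [zero_add]
    exact_mod_cast this

/-- The number of slots that a customer needs at the minimal rate. -/
def slots (K : ℕ) (φ : Fin J → Schedule J → ℝ) (j : Fin J) (x : ℝ) : ℝ :=
  (⌈x / minQuantum K φ j⌉₊ : ℝ)

theorem slots_mono (hK : 1 ≤ K) (hφ : IsServiceQuantum K φ) (j : Fin J) :
    Monotone (slots K φ j) := fun x y hxy => by
  have := minQuantum_pos hK hφ j
  unfold slots
  gcongr

theorem slotCost_eq (K : ℕ) (φ : Fin J → Schedule J → ℝ) :
    slotCost K φ = fun α => ENNReal.ofReal (1 + load (slots K φ) α) := by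
  funext α
  have h : ∀ j, ((α j).map (slots K φ j)).sum =
      (((α j).map fun x => ⌈x / minQuantum K φ j⌉₊).sum : ℕ) := by
    intro j
    rw [Nat.cast_list_sum, List.map_map]
    rfl
  rw [slotCost, ← ENNReal.ofReal_natCast]
  simp only [load, h]
  push_cast
  rfl

theorem sum_schedule {s : Schedule J} (hs : s ∈ schedulesEq J K) : ∑ j, (s j : ℝ) = K := by
  have : ∑ j, s j = K := hs
  exact_mod_cast this

theorem slots_isRegular_and_isStable (hS : ∀ j, 0 < S j) (hp : ∀ j, HasSecondMoment (p j))
    (hK : 1 ≤ K) (hφ : IsServiceQuantum K φ) (hω : IsNonIdling K ω) (hCS : C ⊆ stateVectors K S φ)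
    (hC : IsIrreducibleOn (kernel S φ p ω) C)
    (h : ∑ j, meanArrivals (p j) * (⌈S j / minQuantum K φ j⌉₊ : ℝ) < K) :
    IsRegular (kernel S φ p ω) C (slotCost K φ) ∧ IsStable (kernel S φ p ω) C := by
  rw [slotCost_eq]
  refine isRegular_and_isStable hS hp hφ hω hCS hC one_pos (fun j x hx => ?_)
    (slots_mono hK hφ) h fun s hs => ⟨fun _ => 1, ?_, fun j hj x hx => ?_⟩
  · exact Nat.one_le_cast.2 (Nat.ceil_pos.2 (div_pos hx (minQuantum_pos hK hφ j)))
  · simp [sum_schedule hs]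
  · exact served_ceil_add_one_le (minQuantum_pos hK hφ j) (minQuantum_le φ hs hj) hx

/-- If a class-`j` customer has the same quantum under all full schedules, the slot count is
exact. -/
theorem slots_isUnstable (hS : ∀ j, 0 < S j) (hp : ∀ j, HasSecondMoment (p j))
    (hK : 1 ≤ K) (hφ : IsServiceQuantum K φ) (hω : IsNonIdling K ω) (hCS : C ⊆ stateVectors K S φ)
    (hC : IsClosedSet (kernel S φ p ω) C)
    (hconst : ∀ j, ∀ s ∈ schedulesEq J K, ∀ t ∈ schedulesEq J K, 0 < s j → 0 < t j → s = t)
    (hU : K = 1 ∨ ReachesArbitrarilyMany (kernel S φ p ω) C)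
    (h : K < ∑ j, meanArrivals (p j) * (⌈S j / minQuantum K φ j⌉₊ : ℝ)) :
    IsUnstable (kernel S φ p ω) C := by
  have hw : ∀ j x, 0 < x → 0 ≤ slots K φ j x := fun j x _ => Nat.cast_nonneg _
  have hdrop : ∀ s ∈ schedulesEq J K, ∃ e : Fin J → ℝ, ∑ j, s j * e j ≤ K ∧
      ∀ j, 0 < s j → ∀ x, 0 < x → slots K φ j x ≤ served (slots K φ j) (φ j s) x + e j := by
    refine fun s hs => ⟨fun _ => 1, by simp [sum_schedule hs], fun j hj x _ => ?_⟩
    obtain ⟨t, ht, htj, hφt⟩ := exists_minQuantum_eq hK φ j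
    rw [hconst j s hs t ht hj htj, hφt]
    exact ceil_le_served_add_one (minQuantum_pos hK hφ j)
  refine isUnstable_of_load hS hp hφ hω hCS hC hw (slots_mono hK hφ) (Nat.cast_nonneg K) h hdrop
    fun α hα R => ?_
  rcases hU with rfl | hU
  · exact exists_accessible_load_ge_of_one hS hp hω hCS hC hw (Nat.cast_nonneg 1) h hdrop hα R
  · exact exists_accessible_load_ge hS hp hω hCS hC hw (Nat.cast_nonneg K) h hdrop hU hα R

/-- For `K = 1` the class served fills the schedule; for `J = 1` the total is the only entry. Hence
the quantum of a class under a full schedule always equals `minQuantum`. -/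
theorem schedule_unique (h : K = 1 ∨ J = 1) {j : Fin J} {s t : Schedule J}
    (hs : s ∈ schedulesEq J K) (ht : t ∈ schedulesEq J K) (hsj : 0 < s j) (htj : 0 < t j) :
    s = t := by
  have hs' : ∑ j, s j = K := hs
  have ht' : ∑ j, t j = K := ht
  rw [← Finset.add_sum_erase _ _ (Finset.mem_univ j)] at hs' ht'
  rcases h with rfl | rfl
  · have hs0 : ∑ i ∈ Finset.univ.erase j, s i = 0 := by omega
    have ht0 : ∑ i ∈ Finset.univ.erase j, t i = 0 := by omega
    funext i
    by_cases hi : i = j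
    · subst hi; omega
    · rw [Finset.sum_eq_zero_iff.1 hs0 i (by simp [hi]),
        Finset.sum_eq_zero_iff.1 ht0 i (by simp [hi])]
  · funext i
    obtain rfl := Subsingleton.elim i j
    simp [Subsingleton.elim _ i] at hs' ht'
    omega

/-! #### Work -/

/-- A departing customer may use less than its quantum, so residual work alone can drop by less than
`φ j s`. The extra `ψ j`, released at departure, covers the shortfall. Any upper bound `ψ` on the
full-schedule quanta is allowed, so that the Gaussian case can insert an explicit one. -/
theorem work_isRegular_and_isStable (hS : ∀ j, 0 < S j) (hp : ∀ j, HasSecondMoment (p j))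
    (hφ : IsServiceQuantum K φ) (hω : IsNonIdling K ω) (hCS : C ⊆ stateVectors K S φ)
    (hC : IsIrreducibleOn (kernel S φ p ω) C) {ψ : Fin J → ℝ} (hψ0 : ∀ j, 0 < ψ j)
    (hψ : ∀ s ∈ schedulesEq J K, ∀ j, φ j s ≤ ψ j) {d : ℝ}
    (hd : ∀ s ∈ schedulesEq J K, d ≤ ∑ j, s j * φ j s)
    (h : ∑ j, meanArrivals (p j) * (S j + ψ j) < d) :
    IsRegular (kernel S φ p ω) C
        (fun α => ENNReal.ofReal (1 + load (fun j x => x + ψ j) α)) ∧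
      IsStable (kernel S φ p ω) C := by
  obtain ⟨η, hη, hle⟩ : ∃ η > 0, ∀ j, η ≤ ψ j := by
    rcases isEmpty_or_nonempty (Fin J) with hJ | hJ
    · exact ⟨1, one_pos, fun j => hJ.elim j⟩
    · obtain ⟨j, hj⟩ := Finite.exists_min ψ
      exact ⟨ψ j, hψ0 j, hj⟩
  refine isRegular_and_isStable (w := fun j x => x + ψ j) hS hp hφ hω hCS hC hη
    (fun j x hx => by linarith [hle j]) (fun j x y hxy => by simpa using hxy) h
    fun s hs => ⟨fun j => φ j s, hd s hs, fun j hj x hx => ?_⟩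
  unfold served
  split_ifs
  · linarith
  · linarith [hψ s hs j]

/-- Weighing only the residual work of classes in `B`, a served customer loses at most its quantum,
whether it stays or leaves. -/
theorem work_isUnstable (hS : ∀ j, 0 < S j) (hp : ∀ j, HasSecondMoment (p j))
    (hφ : IsServiceQuantum K φ) (hω : IsNonIdling K ω) (hCS : C ⊆ stateVectors K S φ)
    (hC : IsClosedSet (kernel S φ p ω) C) (hU : ReachesArbitrarilyMany (kernel S φ p ω) C)
    {B : Finset (Fin J)} (hB : B.Nonempty) {D : ℝ}
    (hD : ∀ s ∈ schedulesEq J K, ∑ j ∈ B, s j * φ j s ≤ D)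
    (h : D < ∑ j ∈ B, S j * meanArrivals (p j)) : IsUnstable (kernel S φ p ω) C := by
  have hφ0 : ∀ s ∈ schedulesEq J K, ∀ j, 0 ≤ φ j s := by
    intro s hs j
    obtain ⟨h0, h1⟩ := hφ s (schedulesEq_subset J K hs) j
    rcases (s j).eq_zero_or_pos with h | h
    · exact (h0 h).ge
    · exact (h1 h).le
  -- A class provides a full schedule, serving `K` of its customers, and so `0 ≤ D`.
  obtain ⟨i, -⟩ := hB
  have hD0 : 0 ≤ D := (Finset.sum_nonneg fun j _ => mul_nonneg (Nat.cast_nonneg _)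
    (hφ0 _ (single_mem_schedulesEq K i) j)).trans (hD _ (single_mem_schedulesEq K i))
  set w : Fin J → ℝ → ℝ := fun j x => if j ∈ B then x else 0 with hwdef
  have hw : ∀ j x, 0 < x → 0 ≤ w j x := fun j x hx => by
    simp only [hwdef]; split_ifs <;> [exact hx.le; exact le_rfl]
  have hmono : ∀ j, Monotone (w j) := fun j x y hxy => by
    simp only [hwdef]; split_ifs <;> [exact hxy; exact le_rfl]
  have h' : D < ∑ j, meanArrivals (p j) * w j (S j) := by
    refine h.trans_eq ?_
    simp only [hwdef, mul_ite, mul_zero, Finset.sum_ite_mem, Finset.univ_inter]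
    exact Finset.sum_congr rfl fun j _ => mul_comm _ _
  have hdrop : ∀ s ∈ schedulesEq J K, ∃ e : Fin J → ℝ, ∑ j, s j * e j ≤ D ∧
      ∀ j, 0 < s j → ∀ x, 0 < x → w j x ≤ served (w j) (φ j s) x + e j := by
    refine fun s hs => ⟨fun j => if j ∈ B then φ j s else 0, ?_, fun j hj x _ => ?_⟩
    · simpa only [mul_ite, mul_zero, Finset.sum_ite_mem, Finset.univ_inter] using hD s hs
    · by_cases hjB : j ∈ B
      · simp only [hwdef, hjB, if_true, served]
        split_ifs <;> linarith
      · simp [hwdef, hjB, served]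
  exact isUnstable_of_load hS hp hφ hω hCS hC hw hmono hD0 h' hdrop fun α hα R =>
    exists_accessible_load_ge hS hp hω hCS hC hw hD0 h' hdrop hU hα R

end Instances

/-! #### Gaussian encoding -/

section Gaussian

variable {K : ℕ} {ρ noise : ℝ} {Pw : Fin J → ℝ} {s : Schedule J}

theorem mul_le_sum_power {q : ℝ} (hq : ∀ j, q ≤ Pw j) (hs : s ∈ schedulesEq J K) :
    K * q ≤ ∑ k, (s k : ℝ) * Pw k := by
  rw [← sum_schedule hs, Finset.sum_mul]
  gcongr with j
  exact hq j

/-- From `log (1 + x) ≤ x`, then dropping the noise and replacing the own power by the largest one,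
which keeps the denominator common to all classes. `Q < K * q` makes it positive. -/
theorem gaussianQuantum_le (hρ : 0 < ρ) (hnoise : 0 < noise) (hPw : ∀ j, 0 < Pw j) {q Q : ℝ}
    (hq : ∀ j, q ≤ Pw j) (hQ : ∀ j, Pw j ≤ Q) (hK : Q < K * q) (hs : s ∈ schedulesEq J K)
    (j : Fin J) :
    gaussianQuantum ρ noise Pw j s ≤ ρ / (1 + ρ) * (Pw j / ((∑ k, (s k : ℝ) * Pw k) - Q)) := by
  have hT := mul_le_sum_power hq hs
  set T := ∑ k, (s k : ℝ) * Pw k with hTdef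
  have hTQ : 0 < T - Q := by linarith
  have hP := hPw j
  have hPQ := hQ j
  have hpos : 0 < T - Pw j + noise := by linarith
  unfold gaussianQuantum
  split_ifs with h
  · positivity
  · rw [← hTdef]
    calc ρ * Real.log (1 + Pw j / ((1 + ρ) * (T - Pw j + noise)))
        ≤ ρ * (Pw j / ((1 + ρ) * (T - Pw j + noise))) := by
          gcongr
          have := Real.log_le_sub_one_of_pos
            (x := 1 + Pw j / ((1 + ρ) * (T - Pw j + noise))) (by positivity)
          linarith
      _ = ρ / (1 + ρ) * (Pw j / (T - Pw j + noise)) := by field_simp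
      _ ≤ _ := by
          gcongr
          linarith

/-- From `log (1 + x) ≥ x / (1 + x)`, whose denominator is `(1 + ρ)(T + noise) - ρ * Pw j` for total
power `T`; omitting the last term makes it common to all classes. -/
theorem le_gaussianQuantum (hρ : 0 < ρ) (hnoise : 0 < noise) (hPw : ∀ j, 0 < Pw j) {j : Fin J}
    (hj : 0 < s j) :
    ρ / (1 + ρ) * (Pw j / ((∑ k, (s k : ℝ) * Pw k) + noise)) ≤ gaussianQuantum ρ noise Pw j s := by
  have hPT : Pw j ≤ ∑ k, (s k : ℝ) * Pw k := by
    have h1 : (1 : ℝ) ≤ s j := by exact_mod_cast hj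
    refine le_trans (le_mul_of_one_le_left (hPw j).le h1) (Finset.single_le_sum
      (f := fun k => (s k : ℝ) * Pw k)
      (fun k _ => mul_nonneg (Nat.cast_nonneg _) (hPw k).le) (Finset.mem_univ j))
  rw [gaussianQuantum, if_neg hj.ne']
  set T := ∑ k, (s k : ℝ) * Pw k
  have hP := hPw j
  have hpos : 0 < T - Pw j + noise := by linarith
  set x := Pw j / ((1 + ρ) * (T - Pw j + noise)) with hx
  have hx0 : 0 < x := by positivity
  have h1 : 1 - (1 + x)⁻¹ ≤ Real.log (1 + x) := Real.one_sub_inv_le_log_of_pos (by positivity)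
  have h2 : 1 - (1 + x)⁻¹ = Pw j / ((1 + ρ) * (T - Pw j + noise) + Pw j) := by
    rw [hx]
    field_simp
    ring
  calc ρ / (1 + ρ) * (Pw j / (T + noise)) = ρ * (Pw j / ((1 + ρ) * (T + noise))) := by
        field_simp
    _ ≤ ρ * (Pw j / ((1 + ρ) * (T - Pw j + noise) + Pw j)) := by
        gcongr
        nlinarith
    _ ≤ _ := by
        rw [← h2]
        gcongr

/-- With a common denominator the numerators add up to the total power `T`, and `T / (T - Q)`
decreases in `T ≥ K * q`. -/
theorem sum_gaussianQuantum_le (hρ : 0 < ρ) (hnoise : 0 < noise) (hPw : ∀ j, 0 < Pw j) {q Q : ℝ}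
    (hq : ∀ j, q ≤ Pw j) (hQ0 : 0 < Q) (hQ : ∀ j, Pw j ≤ Q) (hK : Q < K * q)
    (hs : s ∈ schedulesEq J K) :
    ∑ j, s j * gaussianQuantum ρ noise Pw j s ≤ ρ / (1 + ρ) * (K * q / (K * q - Q)) := by
  have hT := mul_le_sum_power hq hs
  calc ∑ j, s j * gaussianQuantum ρ noise Pw j s
      ≤ ∑ j, s j * (ρ / (1 + ρ) * (Pw j / ((∑ k, (s k : ℝ) * Pw k) - Q))) := by
        gcongr with j
        exact gaussianQuantum_le hρ hnoise hPw hq hQ hK hs j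
    _ = ρ / (1 + ρ) * ((∑ k, (s k : ℝ) * Pw k) / ((∑ k, (s k : ℝ) * Pw k) - Q)) := by
        rw [Finset.sum_div, Finset.mul_sum]
        exact Finset.sum_congr rfl fun j _ => by ring
    _ ≤ _ := by
        refine mul_le_mul_of_nonneg_left ?_ (by positivity)
        rw [div_le_div_iff₀ (by linarith) (by linarith)]
        nlinarith

/-- Again the numerators add up to `T`, and now `T / (T + noise)` increases in `T ≥ K * q`. -/
theorem le_sum_gaussianQuantum (hρ : 0 < ρ) (hnoise : 0 < noise) (hPw : ∀ j, 0 < Pw j) {q : ℝ}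
    (hq0 : 0 < q) (hq : ∀ j, q ≤ Pw j) (hs : s ∈ schedulesEq J K) :
    ρ / (1 + ρ) * (K * q / (K * q + noise)) ≤ ∑ j, s j * gaussianQuantum ρ noise Pw j s := by
  have hT := mul_le_sum_power hq hs
  have hKq : 0 ≤ K * q := by positivity
  calc ρ / (1 + ρ) * (K * q / (K * q + noise))
      ≤ ρ / (1 + ρ) * ((∑ k, (s k : ℝ) * Pw k) / ((∑ k, (s k : ℝ) * Pw k) + noise)) := by
        refine mul_le_mul_of_nonneg_left ?_ (by positivity)
        rw [div_le_div_iff₀ (by linarith) (by linarith)]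
        nlinarith
    _ = ∑ j, s j * (ρ / (1 + ρ) * (Pw j / ((∑ k, (s k : ℝ) * Pw k) + noise))) := by
        rw [Finset.sum_div, Finset.mul_sum]
        exact Finset.sum_congr rfl fun j _ => by ring
    _ ≤ _ := by
        refine Finset.sum_le_sum fun j _ => ?_
        rcases (s j).eq_zero_or_pos with h | h
        · simp [h]
        · gcongr
          exact le_gaussianQuantum hρ hnoise hPw h

theorem tendsto_div_add_const (a : ℝ) {q : ℝ} (hq : 0 < q) :
    Filter.Tendsto (fun K : ℕ => (K : ℝ) * q / (K * q + a)) Filter.atTop (nhds 1) := by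
  have h0 : Filter.Tendsto (fun K : ℕ => (K : ℝ) * q) Filter.atTop Filter.atTop :=
    tendsto_natCast_atTop_atTop.atTop_mul_const hq
  have h1 : Filter.Tendsto (fun K : ℕ => (K : ℝ) * q + a) Filter.atTop Filter.atTop :=
    Filter.tendsto_atTop_add_const_right _ a h0
  have h2 : Filter.Tendsto (fun K : ℕ => 1 - a / ((K : ℝ) * q + a)) Filter.atTop (nhds 1) := by
    simpa using tendsto_const_nhds.sub (h1.const_div_atTop a)
  refine h2.congr' ?_
  filter_upwards [h1.eventually_gt_atTop 0] with K hK
  field_simp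
  ring

end Gaussian

end Queue

end

/-! ### The finite-`K` bounds and the Gaussian limit -/

theorem mainTheorem7 {J : ℕ} (hJ : 1 ≤ J) (S : Fin J → ℝ) (hS : ∀ j, 0 < S j)
    (p : Fin J → PMF ℕ) (hp : ∀ j, Queue.HasSecondMoment (p j)) :
    -- results for finite `K`
    (∀ K : ℕ, 1 ≤ K → ∀ φ : Fin J → Queue.Schedule J → ℝ, Queue.IsServiceQuantum K φ →
      ∀ ω : Queue.State J → PMF (Queue.Schedule J), Queue.IsNonIdling K ω →
      ∀ C ⊆ Queue.stateVectors K S φ,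
        -- first inner bound
        (MarkovChain.IsIrreducibleOn (Queue.kernel S φ p ω) C →
          ∑ j, Queue.meanArrivals (p j) * (⌈S j / Queue.minQuantum K φ j⌉₊ : ℝ) < K →
          MarkovChain.IsRegular (Queue.kernel S φ p ω) C (Queue.slotCost K φ) ∧
            Queue.IsStable (Queue.kernel S φ p ω) C) ∧
        -- second inner bound
        (MarkovChain.IsIrreducibleOn (Queue.kernel S φ p ω) C →
          ∑ j, Queue.meanArrivals (p j) * (S j + Queue.maxQuantum K φ j)
            < Queue.minTotalQuantum K φ →
          MarkovChain.IsRegular (Queue.kernel S φ p ω) C (Queue.workCost K φ) ∧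
            Queue.IsStable (Queue.kernel S φ p ω) C) ∧
        -- outer bound
        (∀ B : Finset (Fin J), B.Nonempty →
          MarkovChain.IsClosedSet (Queue.kernel S φ p ω) C →
          Queue.ReachesArbitrarilyMany (Queue.kernel S φ p ω) C →
          Queue.maxTotalQuantum K φ B < ∑ j ∈ B, S j * Queue.meanArrivals (p j) →
          Queue.IsUnstable (Queue.kernel S φ p ω) C) ∧
        -- the threshold for `K = 1` or `J = 1`
        (K = 1 ∨ J = 1 →
          (MarkovChain.IsIrreducibleOn (Queue.kernel S φ p ω) C →
            ∑ j, Queue.meanArrivals (p j) * (⌈S j / Queue.minQuantum K φ j⌉₊ : ℝ) < K →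
            Queue.IsStable (Queue.kernel S φ p ω) C) ∧
          (MarkovChain.IsClosedSet (Queue.kernel S φ p ω) C →
            (K = 1 ∨ Queue.ReachesArbitrarilyMany (Queue.kernel S φ p ω) C) →
            (K : ℝ) < ∑ j, Queue.meanArrivals (p j) * (⌈S j / Queue.minQuantum K φ j⌉₊ : ℝ) →
            Queue.IsUnstable (Queue.kernel S φ p ω) C))) ∧
    -- the threshold for Gaussian encoding as `K → ∞`
    (∀ ρ noise : ℝ, 0 < ρ → ρ ≤ 1 → 0 < noise →
      ∀ Pw : Fin J → ℝ, (∀ j, 0 < Pw j) →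
        (∑ j, Queue.meanArrivals (p j) * S j < ρ / (1 + ρ) →
          ∃ K₀ : ℕ, ∀ K ≥ K₀,
            ∀ ω : Queue.State J → PMF (Queue.Schedule J), Queue.IsNonIdling K ω →
            ∀ C ⊆ Queue.stateVectors K S (Queue.gaussianQuantum ρ noise Pw),
              MarkovChain.IsIrreducibleOn
                (Queue.kernel S (Queue.gaussianQuantum ρ noise Pw) p ω) C →
              Queue.IsStable (Queue.kernel S (Queue.gaussianQuantum ρ noise Pw) p ω) C) ∧
        (ρ / (1 + ρ) < ∑ j, Queue.meanArrivals (p j) * S j →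
          ∃ K₀ : ℕ, ∀ K ≥ K₀,
            ∀ ω : Queue.State J → PMF (Queue.Schedule J), Queue.IsNonIdling K ω →
            ∀ C ⊆ Queue.stateVectors K S (Queue.gaussianQuantum ρ noise Pw),
              MarkovChain.IsClosedSet
                (Queue.kernel S (Queue.gaussianQuantum ρ noise Pw) p ω) C →
              Queue.ReachesArbitrarilyMany
                (Queue.kernel S (Queue.gaussianQuantum ρ noise Pw) p ω) C →
              Queue.IsUnstable (Queue.kernel S (Queue.gaussianQuantum ρ noise Pw) p ω) C)) := by
  constructor
  · intro K hK φ hφ ω hω C hCS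
    refine ⟨fun hC h => Queue.slots_isRegular_and_isStable hS hp hK hφ hω hCS hC h, fun hC h => ?_,
      fun B hB hC hU h => ?_, fun hKJ => ⟨fun hC h =>
        (Queue.slots_isRegular_and_isStable hS hp hK hφ hω hCS hC h).2, fun hC hU h => ?_⟩⟩
    · have hle : ∀ s ∈ Queue.schedulesLE J K, ∀ j, φ j s ≤ Queue.maxQuantum K φ j := fun s hs j =>
        le_csSup ((Queue.finite_schedulesLE J K).image (φ j)).bddAbove ⟨s, hs, rfl⟩
      refine Queue.work_isRegular_and_isStable hS hp hφ hω hCS hC (fun j => ?_)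
        (fun s hs => hle s (Queue.schedulesEq_subset J K hs)) (fun s hs => ?_) h
      · have hs := Queue.schedulesEq_subset J K (Queue.single_mem_schedulesEq K j)
        exact ((hφ _ hs j).2 (by simp; omega)).trans_le (hle _ hs j)
      · exact csInf_le ((Queue.finite_schedulesEq J K).image _).bddBelow ⟨s, hs, rfl⟩
    · exact Queue.work_isUnstable hS hp hφ hω hCS hC hU hB (fun s hs =>
        le_csSup ((Queue.finite_schedulesEq J K).image
          fun s => ∑ j ∈ B, (s j : ℝ) * φ j s).bddAbove ⟨s, hs, rfl⟩) h
    · exact Queue.slots_isUnstable hS hp hK hφ hω hCS hC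
        (fun j s hs t ht => Queue.schedule_unique hKJ hs ht) hU h
  · intro ρ noise hρ _ hnoise Pw hPw
    have : Nonempty (Fin J) := ⟨⟨0, hJ⟩⟩
    obtain ⟨i, hi⟩ := Finite.exists_min Pw
    obtain ⟨i', hi'⟩ := Finite.exists_max Pw
    have hq0 := hPw i
    have hQ0 := hPw i'
    set q := Pw i
    set Q := Pw i'
    set r := ρ / (1 + ρ) with hr
    have hr0 : 0 < r := by positivity
    have hlarge : ∀ᶠ K : ℕ in Filter.atTop, Q < K * q :=
      (tendsto_natCast_atTop_atTop.atTop_mul_const hq0).eventually_gt_atTop Q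
    constructor
    · intro h
      have h1 : Filter.Tendsto (fun K : ℕ => r * ((K : ℝ) * q / (K * q + noise))) Filter.atTop
          (nhds r) := by
        simpa using (Queue.tendsto_div_add_const noise hq0).const_mul r
      -- This uniform bound on a single quantum serves as `ψ`; since it vanishes as `K → ∞`, the
      -- overshoot correction disappears from the stability condition.
      have h2 : Filter.Tendsto (fun K : ℕ => r * (Q / ((K : ℝ) * q - Q))) Filter.atTop
          (nhds 0) := by
        have h0 : Filter.Tendsto (fun K : ℕ => (K : ℝ) * q - Q) Filter.atTop Filter.atTop :=
          Filter.tendsto_atTop_add_const_right _ (-Q)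
            (tendsto_natCast_atTop_atTop.atTop_mul_const hq0)
        simpa using (h0.const_div_atTop Q).const_mul r
      have h3 : Filter.Tendsto (fun K : ℕ => ∑ j, Queue.meanArrivals (p j) *
          (S j + r * (Q / ((K : ℝ) * q - Q)))) Filter.atTop
          (nhds (∑ j, Queue.meanArrivals (p j) * S j)) := by
        refine tendsto_finsetSum _ fun j _ => ?_
        simpa using (h2.const_add (S j)).const_mul (Queue.meanArrivals (p j))
      obtain ⟨K₀, hK₀⟩ := Filter.eventually_atTop.1 (hlarge.and (h3.eventually_lt h1 h))
      refine ⟨K₀, fun K hK ω hω C hCS hC => ?_⟩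
      obtain ⟨hKq, hlt⟩ := hK₀ K hK
      have hKQ : 0 < K * q - Q := sub_pos.2 hKq
      refine (Queue.work_isRegular_and_isStable hS hp
        (Queue.gaussianQuantum_isServiceQuantum K hρ hnoise hPw) hω hCS hC
        (fun j => by positivity) (fun s hs j => ?_)
        (fun s hs => Queue.le_sum_gaussianQuantum hρ hnoise hPw hq0 hi hs) hlt).2
      refine (Queue.gaussianQuantum_le hρ hnoise hPw hi hi' hKq hs j).trans ?_
      have hT := Queue.mul_le_sum_power hi hs
      have hj := hi' j
      rw [← hr]
      gcongr
    · intro h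
      have h1 : Filter.Tendsto (fun K : ℕ => r * ((K : ℝ) * q / (K * q - Q))) Filter.atTop
          (nhds r) := by
        simpa [sub_eq_add_neg] using (Queue.tendsto_div_add_const (-Q) hq0).const_mul r
      obtain ⟨K₀, hK₀⟩ := Filter.eventually_atTop.1 (hlarge.and (h1.eventually_lt_const h))
      refine ⟨K₀, fun K hK ω hω C hCS hC hU => ?_⟩
      obtain ⟨hKq, hlt⟩ := hK₀ K hK
      refine Queue.work_isUnstable hS hp
        (Queue.gaussianQuantum_isServiceQuantum K hρ hnoise hPw) hω hCS hC hU
        Finset.univ_nonempty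
        (fun s hs => Queue.sum_gaussianQuantum_le hρ hnoise hPw hi hQ0 hi' hKq hs)
        (hlt.trans_eq (Finset.sum_congr rfl fun j _ => mul_comm _ _))
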